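/- **Setting.** Consider a hybrid Markov decision process with state space a Borel set $\mathcal S\subseteq\mathbb R^{d}$, finite set $\mathcal X$ of discrete actions, feasible continuous actions $\mathcal B^x\subseteq\mathbb R^p$ for each $x\in\mathcal X$, actions $a=(x,b)$ with $b\in\mathcal B^x$, transitions $s_{t+1}=f(s_t,a_t,\xi_t)\in\mathcal S$ with i.i.d. exogenous disturbances $\xi_t$, bounded cost $c(s,a,\xi)$, and discount factor $\gamma\in(0,1)$ ($f$ and $c$ measurable). A policy is a pair $(\pi^{\mathcal X},\pi^{\mathcal B}_\kappa)$: the discrete component $\pi^{\mathcal X}$ is a (measurable, stationary) map from states to probability distributions on $\mathcal X$, and the continuous component with parameter $\kappa\in\mathbb R^m$ provides deterministically one feasible action $b_\kappa(s,x)\in\mathcal B^x$ for each state $s$ and $x\in\mathcal X$; at time $t$ one draws $x_t\sim\pi^{\mathcal X}(\cdot\mid s_t)$, independently of $\xi_t$ and, given $s_t$, of the past, and plays $a_t=(x_t,b_\kappa(s_t,x_t))$. Let $$V_\pi(s)=\mathbb E_\pi\Big[\sum_{t\ge0}\gamma^t c(s_t,a_t,\xi_t)\,\Big|\,s_0=s\Big],\qquad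 Q_\pi(s,a)=\mathbb E_{\xi}\big[c(s,a,\xi)+\gamma V_\pi(f(s,a,\xi))\big].$$ For a fixed realization of $s_0$, $(x_t)_{t\ge 0}$ and $(\xi_t)_{t\ge 0}$, let $s_t(\kappa)$ denote the state at time $t$ as a function of $\kappa$: $s_0(\kappa)=s_0$ and $s_{t+1}(\kappa)=f\big(s_t(\kappa),(x_t,b_\kappa(s_t(\kappa),x_t)),\xi_t\big)$. Let $(\pi^{\mathcal X}_\phi)_\phi$ be a family of discrete components, $\mathcal K\subseteq\mathbb R^m$ a set of parameters, $\rho$ an initial state distribution on $\mathcal S$; for $\theta=(\phi,\kappa)$ write $\pi_\theta=(\pi^{\mathcal X}_\phi,\pi^{\mathcal B}_\kappa)$ and let $\mathbb E_\theta$ be the expectation under $\pi_\theta$ with $s_0\sim\rho$. **Assumptions.** There are finite constants $C,L_\pi,L_s$ such that for all $\kappa\in\mathcal K$: 1. *(Statewise best response)* there is a discrete component $\pi^{\mathcal X}(\kappa)$ such that $\pi^*_\kappa:=(\pi^{\mathcal X}(\kappa),\pi^{\mathcal B}_\kappa)$ satisfies $V_{\pi^*_\kappa}(s)=\min_{\pi^{\mathcal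 X}}V_{(\pi^{\mathcal X},\pi^{\mathcal B}_\kappa)}(s)$ for all $s\in\mathcal S$, the minimum being over all discrete components. Call $\pi^{\mathcal X}_\phi$ an *$\epsilon$-best response* to $\kappa$ if $\mathbb E_{s_0\sim\rho}[V_{\pi_{(\phi,\kappa)}}(s_0)-V_{\pi^*_\kappa}(s_0)]\le\epsilon$. 2. *(Uniform near-best response)* for every $\epsilon$, if $\pi^{\mathcal X}_\phi$ is any $\epsilon$-best response to $\kappa$, then $\mathbb E_{s_0\sim\rho'}[V_{\pi_{(\phi,\kappa)}}(s_0)-V_{\pi^*_\kappa}(s_0)]\le C\epsilon$ for every probability distribution $\rho'$ on $\mathcal S$. 3. *(State and score sensitivity)* for $\rho$-almost every $s_0$, all $t\ge1$ and all realizations of the discrete actions and disturbances, $s_t(\cdot)$ is differentiable at $\kappa$ with $\|\nabla_\kappa s_t(\kappa)\|\le L_s$ (operator norm); and for all $\phi$, $s\in\mathcal S$, $x\in\mathcal X$ one has $\pi^{\mathcal X}_\phi(x\mid s)>0$, and $\log\pi^{\mathcal X}_\phi(x\mid\cdot)$ has at $s$, relative to $\mathcal S$, a gradient with $\|\nabla_s\log\pi^{\mathcal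 X}_\phi(x\mid s)\|\le L_\pi$. **Theorem.** For any $\kappa\in\mathcal K$ and any $\epsilon$-best response $\pi^{\mathcal X}_\phi$ to $\kappa$, the series below converges almost surely, its sum is integrable, and $$\left\|\mathbb E_\theta\Big[\sum_{t\ge0}\gamma^t\,\nabla_\kappa\log\pi^{\mathcal X}_\phi\big(x_t\mid s_t(\kappa)\big)\,Q_{\pi_\theta}(s_t(\kappa),a_t)\Big]\right\|\le\epsilon\, L_\pi L_s\left(1+\frac{C\gamma}{1-\gamma}\right).$$ -/

import Mathlib

open MeasureTheory ProbabilityTheory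

noncomputable section

/-- A hybrid discrete-continuous MDP in disturbance form, with exogenous noise. States are vectors
in `S ⊆ ℝ^d`, an action is a pair `(x, b)` with `x` in the finite set `X` and `b ∈ B x ⊆ ℝ^p`,
and the exogenous disturbances are i.i.d. with law `noise`. The transition map `f` and the
cost `c` are total functions; only their values on states in `S` and feasible actions matter. -/
structure HybridMDP (d p : ℕ) (X Ξ : Type*) [MeasurableSpace Ξ] where
  /-- state space -/
  S : Set (EuclideanSpace ℝ (Fin d))
  /-- feasible continuous actions for each discrete action -/
  B : X → Set (EuclideanSpace ℝ (Fin p))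
  /-- transition map `f(s, (x, b), ξ)` -/
  f : EuclideanSpace ℝ (Fin d) → X → EuclideanSpace ℝ (Fin p) → Ξ → EuclideanSpace ℝ (Fin d)
  /-- cost `c(s, (x, b), ξ)` -/
  c : EuclideanSpace ℝ (Fin d) → X → EuclideanSpace ℝ (Fin p) → Ξ → ℝ
  /-- law of a single exogenous disturbance -/
  noise : Measure Ξ
  isProbabilityMeasure_noise : IsProbabilityMeasure noise
  measurableSet_S : MeasurableSet S
  f_mem : ∀ s ∈ S, ∀ x, ∀ b ∈ B x, ∀ ξ, f s x b ξ ∈ S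
  measurable_f : ∀ x, Measurable
    fun z : EuclideanSpace ℝ (Fin d) × EuclideanSpace ℝ (Fin p) × Ξ => f z.1 x z.2.1 z.2.2
  measurable_c : ∀ x, Measurable
    fun z : EuclideanSpace ℝ (Fin d) × EuclideanSpace ℝ (Fin p) × Ξ => c z.1 x z.2.1 z.2.2

/-- A (stationary, randomized) discrete policy component: a Markov kernel from states to `X`. -/
structure DiscretePolicy (d : ℕ) (X : Type*) [MeasurableSpace X] where
  /-- the law of the discrete action in each state -/
  kernel : Kernel (EuclideanSpace ℝ (Fin d)) X
  isMarkovKernel_kernel : IsMarkovKernel kernel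

/-- The probability `π(x | s)`. -/
def DiscretePolicy.prob {d : ℕ} {X : Type*} [MeasurableSpace X] (π : DiscretePolicy d X)
    (x : X) (s : EuclideanSpace ℝ (Fin d)) : ℝ :=
  (π.kernel s).real {x}

namespace HybridMDP

variable {d p m : ℕ} {X Ξ : Type*} [MeasurableSpace Ξ]

/-- A deterministic continuous policy component with parameter `κ ∈ ℝ^m`: in state `s` it
provides one feasible continuous candidate action `b_κ(s, x)` for every discrete action `x`. -/
structure ContinuousPolicy (M : HybridMDP d p X Ξ) (m : ℕ) where
  /-- the candidate action `b_κ(s, x)` -/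
  act : EuclideanSpace ℝ (Fin m) → EuclideanSpace ℝ (Fin d) → X → EuclideanSpace ℝ (Fin p)
  act_mem : ∀ κ, ∀ s ∈ M.S, ∀ x, act κ s x ∈ M.B x
  measurable_act : ∀ κ x, Measurable fun s => act κ s x

/-- The state `s_t(κ)` along fixed realizations of the initial state, of the discrete
actions and of the disturbances, as a function of `κ`. -/
def stateAt (M : HybridMDP d p X Ξ) (β : M.ContinuousPolicy m)
    (s₀ : EuclideanSpace ℝ (Fin d)) (x : ℕ → X) (ξ : ℕ → Ξ) :
    ℕ → EuclideanSpace ℝ (Fin m) → EuclideanSpace ℝ (Fin d)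
  | 0, _ => s₀
  | t + 1, κ =>
      M.f (M.stateAt β s₀ x ξ t κ) (x t) (β.act κ (M.stateAt β s₀ x ξ t κ) (x t)) (ξ t)

/-- One transition of the state under the continuous component with parameter `κ`,
given the current state, discrete action and disturbance. -/
def next (M : HybridMDP d p X Ξ) (β : M.ContinuousPolicy m) (κ : EuclideanSpace ℝ (Fin m))
    (z : EuclideanSpace ℝ (Fin d) × X × Ξ) : EuclideanSpace ℝ (Fin d) :=
  M.f z.1 z.2.1 (β.act κ z.1 z.2.1) z.2.2

variable [Fintype X] [MeasurableSpace X] [MeasurableSingletonClass X]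

theorem measurable_next (M : HybridMDP d p X Ξ) (β : M.ContinuousPolicy m)
    (κ : EuclideanSpace ℝ (Fin m)) : Measurable (M.next β κ) := by
  have h : Measurable fun z : X × (EuclideanSpace ℝ (Fin d) × Ξ) =>
      M.f z.2.1 z.1 (β.act κ z.2.1 z.1) z.2.2 := by
    refine measurable_from_prod_countable_right fun x => ?_
    exact (M.measurable_f x).comp (measurable_fst.prodMk
      (((β.measurable_act κ x).comp measurable_fst).prodMk measurable_snd))
  exact h.comp ((measurable_fst.comp measurable_snd).prodMk
    (measurable_fst.prodMk (measurable_snd.comp measurable_snd)))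

/-- Given a state `s`, the law of `(s, x, ξ)` with `x ∼ π(· | s)` and an independent fresh
disturbance `ξ`. -/
def drawKernel (M : HybridMDP d p X Ξ) (π : DiscretePolicy d X) :
    Kernel (EuclideanSpace ℝ (Fin d)) (EuclideanSpace ℝ (Fin d) × X × Ξ) :=
  Kernel.id ×ₖ (π.kernel ×ₖ Kernel.const _ M.noise)

instance (M : HybridMDP d p X Ξ) (π : DiscretePolicy d X) : IsMarkovKernel (M.drawKernel π) := by
  have := M.isProbabilityMeasure_noise
  have := π.isMarkovKernel_kernel
  unfold drawKernel
  infer_instance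

/-- The one-step kernel of the trajectory `(s_t, x_t, ξ_t)`, given its past up to time `n`. -/
def stepKernel (M : HybridMDP d p X Ξ) (β : M.ContinuousPolicy m) (κ : EuclideanSpace ℝ (Fin m))
    (π : DiscretePolicy d X) (n : ℕ) :
    Kernel ((i : Finset.Iic n) → EuclideanSpace ℝ (Fin d) × X × Ξ)
      (EuclideanSpace ℝ (Fin d) × X × Ξ) :=
  (M.drawKernel π).comap (fun h => M.next β κ (h ⟨n, Finset.mem_Iic.2 le_rfl⟩))
    ((M.measurable_next β κ).comp (measurable_pi_apply _))

instance (M : HybridMDP d p X Ξ) (β : M.ContinuousPolicy m) (κ : EuclideanSpace ℝ (Fin m))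
    (π : DiscretePolicy d X) (n : ℕ) : IsMarkovKernel (M.stepKernel β κ π n) := by
  unfold stepKernel
  infer_instance

/-- The law of the trajectory `(s_t, x_t, ξ_t)_{t ≥ 0}` under the policy formed by `π` and by
`β` with parameter `κ`, when `s_0 ∼ ρ`. -/
def law (M : HybridMDP d p X Ξ) (β : M.ContinuousPolicy m) (κ : EuclideanSpace ℝ (Fin m))
    (π : DiscretePolicy d X) (ρ : Measure (EuclideanSpace ℝ (Fin d))) [IsProbabilityMeasure ρ] :
    Measure (ℕ → EuclideanSpace ℝ (Fin d) × X × Ξ) :=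
  Kernel.trajMeasure (X := fun _ => EuclideanSpace ℝ (Fin d) × X × Ξ)
    (ρ.bind (M.drawKernel π)) (M.stepKernel β κ π)

/-- The state `s_t(κ)` as a function of `κ` along a sampled trajectory. Only the initial state,
the discrete actions and the disturbances of the trajectory are used. -/
def stateAlong (M : HybridMDP d p X Ξ) (β : M.ContinuousPolicy m)
    (ω : ℕ → EuclideanSpace ℝ (Fin d) × X × Ξ) (t : ℕ) (κ : EuclideanSpace ℝ (Fin m)) :
    EuclideanSpace ℝ (Fin d) :=
  M.stateAt β (ω 0).1 (fun i => (ω i).2.1) (fun i => (ω i).2.2) t κ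

/-- The value function `V(s)`: expected total discounted cost from the initial state `s`. -/
def value (M : HybridMDP d p X Ξ) (γ : ℝ) (β : M.ContinuousPolicy m)
    (κ : EuclideanSpace ℝ (Fin m)) (π : DiscretePolicy d X) (s : EuclideanSpace ℝ (Fin d)) : ℝ :=
  ∫ ω, ∑' t : ℕ, γ ^ t * M.c (M.stateAlong β ω t κ) (ω t).2.1
    (β.act κ (M.stateAlong β ω t κ) (ω t).2.1) (ω t).2.2 ∂(M.law β κ π (Measure.dirac s))

/-- The action-value function `Q(s, (x, b))`: expected total discounted cost of taking the action
`(x, b)` in state `s` and following the policy afterwards. -/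
def actionValue (M : HybridMDP d p X Ξ) (γ : ℝ) (β : M.ContinuousPolicy m)
    (κ : EuclideanSpace ℝ (Fin m)) (π : DiscretePolicy d X) (s : EuclideanSpace ℝ (Fin d))
    (x : X) (b : EuclideanSpace ℝ (Fin p)) : ℝ :=
  ∫ ξ, (M.c s x b ξ + γ * M.value γ β κ π (M.f s x b ξ)) ∂M.noise

/-- `π` is a statewise best response to `κ`: from every state it attains the minimal value among
all discrete policies. -/
def IsStatewiseBestResponse (M : HybridMDP d p X Ξ) (γ : ℝ) (β : M.ContinuousPolicy m)
    (κ : EuclideanSpace ℝ (Fin m)) (π : DiscretePolicy d X) : Prop :=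
  ∀ s ∈ M.S, ∀ π' : DiscretePolicy d X, M.value γ β κ π s ≤ M.value γ β κ π' s

/-- The expected suboptimality `E_{s ∼ ρ}[V_π(s) - V_{π'}(s)]` of `π` relative to `π'`. -/
def gap (M : HybridMDP d p X Ξ) (γ : ℝ) (β : M.ContinuousPolicy m)
    (κ : EuclideanSpace ℝ (Fin m)) (π π' : DiscretePolicy d X)
    (ρ : Measure (EuclideanSpace ℝ (Fin d))) : ℝ :=
  ∫ s, (M.value γ β κ π s - M.value γ β κ π' s) ∂ρ

/-- The random variable inside the expectation of the cross term:
at time `t`, `γ^t • ∇_κ log π(x_t | s_t(κ)) Q(s_t(κ), a_t)`. -/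
def crossSummand (M : HybridMDP d p X Ξ) (γ : ℝ) (β : M.ContinuousPolicy m)
    (κ : EuclideanSpace ℝ (Fin m)) (π : DiscretePolicy d X)
    (ω : ℕ → EuclideanSpace ℝ (Fin d) × X × Ξ) (t : ℕ) : EuclideanSpace ℝ (Fin m) :=
  (γ ^ t * M.actionValue γ β κ π (M.stateAlong β ω t κ) (ω t).2.1
      (β.act κ (M.stateAlong β ω t κ) (ω t).2.1)) •
    gradient (fun κ' => Real.log (π.prob (ω t).2.1 (M.stateAlong β ω t κ'))) κ

end HybridMDP

end

/-!
The cross term at time `t` pairs the score `∇_κ log π(x_t | s_t(κ))` with `Q_π(s_t, a_t)`.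
Given the past, `s_t(·)` is a fixed function of `κ` and only `x_t ∼ π(· | s_t)` is random, so
differentiating `∑_x π(x | s_t(κ)) = 1` shows that the score has conditional mean zero
(`SensitiveOn.sum_prob_smul_score`). Hence any function of `s_t` may be subtracted from `Q_π`
(`SensitiveOn.integral_scoreTerm_eq_zero`), and the function subtracted is the optimal value `V*`.

By optimality of the statewise best response, `V*(s) ≤ Q*(s, x) ≤ Q_π(s, x)`
(`IsStatewiseBestResponse.clampValue_le`), so `|Q_π - V*| = Q_π - V*`, whose expectation at time `t`
is `E[V_π(s_t) - V*(s_t)]` by the Bellman equation. This is the suboptimality gap for the law of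
`s_t`, hence at most `C ε`. The chain rule bounds the score by `L_π L_s`, so the term at time
`t ≥ 1` is at most `γ^t L_π L_s C ε`; the one at time `0` vanishes, since `s_0` does not depend on
`κ`. Summing the geometric series gives a bound that is even smaller than the claimed one, by
`ε L_π L_s`.

Two devices take care of measurability. The cost is truncated, which changes nothing on `S` and
makes the value functions bounded and measurable everywhere (`clampValue`); and the score is set to
zero off a measurable set of good initial states, which makes it a pointwise limit of difference
quotients and thus measurable (`score`).
-/

/-! ### Discrete policies, the draw kernel and the law of the trajectory -/

namespace DiscretePolicy

variable {d : ℕ} {X : Type*} [MeasurableSpace X]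

theorem prob_nonneg (π : DiscretePolicy d X) (x : X) (s : EuclideanSpace ℝ (Fin d)) :
    0 ≤ π.prob x s :=
  measureReal_nonneg

theorem sum_prob [Fintype X] [MeasurableSingletonClass X] (π : DiscretePolicy d X)
    (s : EuclideanSpace ℝ (Fin d)) :
    ∑ x, π.prob x s = 1 := by
  have := π.isMarkovKernel_kernel
  have h := integral_fintype (μ := π.kernel s) (f := fun _ => (1 : ℝ)) .of_finite
  simp_all [prob]

theorem measurable_prob [MeasurableSingletonClass X] (π : DiscretePolicy d X) (x : X) :
    Measurable (π.prob x) :=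
  (π.kernel.measurable_coe (measurableSet_singleton x)).ennreal_toReal

theorem sum_prob_mul_le [Fintype X] [MeasurableSingletonClass X] (π : DiscretePolicy d X)
    (s : EuclideanSpace ℝ (Fin d)) {F : X → ℝ} {a : ℝ} (h : ∀ x, F x ≤ a) :
    ∑ x, π.prob x s * F x ≤ a := by
  calc ∑ x, π.prob x s * F x ≤ ∑ x, π.prob x s * a :=
        Finset.sum_le_sum fun x _ => mul_le_mul_of_nonneg_left (h x) (π.prob_nonneg x s)
    _ = a := by rw [← Finset.sum_mul, π.sum_prob, one_mul]

end DiscretePolicy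

namespace HybridMDP

variable {d p m : ℕ} {X Ξ : Type*} [MeasurableSpace Ξ] [MeasurableSpace X]
  {V : Type*} [NormedAddCommGroup V] [NormedSpace ℝ V]

instance (M : HybridMDP d p X Ξ) : IsProbabilityMeasure M.noise :=
  M.isProbabilityMeasure_noise

theorem drawKernel_apply (M : HybridMDP d p X Ξ) (π : DiscretePolicy d X)
    (s : EuclideanSpace ℝ (Fin d)) :
    M.drawKernel π s = ((π.kernel s).prod M.noise).map (Prod.mk s) := by
  have := π.isMarkovKernel_kernel
  rw [drawKernel, Kernel.prod_apply, Kernel.prod_apply, Kernel.id_apply, Kernel.const_apply,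
    Measure.dirac_prod]

theorem ae_drawKernel_fst (M : HybridMDP d p X Ξ) (π : DiscretePolicy d X)
    (s : EuclideanSpace ℝ (Fin d)) : ∀ᵐ z ∂M.drawKernel π s, z.1 = s := by
  have h : MeasurableSet {z : EuclideanSpace ℝ (Fin d) × X × Ξ | z.1 = s} :=
    measurable_fst (measurableSet_singleton s)
  rw [drawKernel_apply, ae_map_iff (by fun_prop) h]
  exact ae_of_all _ fun _ => rfl

variable [Fintype X] [MeasurableSingletonClass X]

theorem integral_drawKernel [CompleteSpace V] (M : HybridMDP d p X Ξ) (π : DiscretePolicy d X)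
    (s : EuclideanSpace ℝ (Fin d)) {k : EuclideanSpace ℝ (Fin d) × X × Ξ → V}
    (hk : StronglyMeasurable k) {a : ℝ} (ha : ∀ z, ‖k z‖ ≤ a) :
    ∫ z, k z ∂M.drawKernel π s = ∑ x, π.prob x s • ∫ ξ, k (s, x, ξ) ∂M.noise := by
  have := π.isMarkovKernel_kernel
  rw [drawKernel_apply, integral_map (by fun_prop) hk.aestronglyMeasurable, integral_prod,
    integral_fintype .of_finite]
  · rfl
  · exact .of_bound (hk.comp_measurable measurable_prodMk_left).aestronglyMeasurable a
      (ae_of_all _ fun _ => ha _)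

section Law

variable (M : HybridMDP d p X Ξ) (β : M.ContinuousPolicy m) (κ : EuclideanSpace ℝ (Fin m))
  (π : DiscretePolicy d X) (ρ : Measure (EuclideanSpace ℝ (Fin d))) [IsProbabilityMeasure ρ]

instance : IsProbabilityMeasure (M.law β κ π ρ) := by
  unfold law
  infer_instance

theorem map_law_zero : (M.law β κ π ρ).map (fun ω => ω 0) = ρ.bind (M.drawKernel π) := by
  have h : (fun ω : ℕ → EuclideanSpace ℝ (Fin d) × X × Ξ => ω 0) =
      (fun h : (i : Finset.Iic 0) → EuclideanSpace ℝ (Fin d) × X × Ξ =>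
        h ⟨0, Finset.mem_Iic.2 le_rfl⟩) ∘ Preorder.frestrictLe 0 := rfl
  rw [law, Kernel.trajMeasure, h, ← Measure.map_map (by fun_prop) (by fun_prop),
    Measure.map_comp _ _ (by fun_prop), Kernel.traj_map_frestrictLe, Kernel.partialTraj_self,
    Measure.id_comp, Measure.map_map (by fun_prop) (by fun_prop)]
  convert! Measure.map_id

theorem map_law_zero_fst : (M.law β κ π ρ).map (fun ω => (ω 0).1) = ρ := by
  have h : (fun ω : ℕ → EuclideanSpace ℝ (Fin d) × X × Ξ => (ω 0).1) =
    Prod.fst ∘ fun ω => ω 0 := rfl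
  rw [h, ← Measure.map_map (by fun_prop) (by fun_prop), map_law_zero]
  have := π.isMarkovKernel_kernel
  rw [Measure.map_comp _ _ measurable_fst, ← Kernel.fst_eq, drawKernel, Kernel.fst_prod,
    Measure.id_comp]

theorem map_law_succ (n : ℕ) :
    (M.law β κ π ρ).map (fun ω => (Preorder.frestrictLe n ω, ω (n + 1))) =
      (M.law β κ π ρ).map (Preorder.frestrictLe n) ⊗ₘ M.stepKernel β κ π n :=
  Kernel.map_frestrictLe_trajMeasure_compProd_eq_map_trajMeasure.symm

/-- The Markov property of the trajectory: given the past up to time `n`, the law of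
`(s_{n+1}, x_{n+1}, ξ_{n+1})` is the draw kernel at the successor of `(s_n, x_n, ξ_n)`. -/
theorem integral_law_succ (n : ℕ)
    {F : ((i : Finset.Iic n) → EuclideanSpace ℝ (Fin d) × X × Ξ) →
      EuclideanSpace ℝ (Fin d) × X × Ξ → V}
    (hF : StronglyMeasurable (Function.uncurry F)) {a : ℝ} (ha : ∀ h z, ‖F h z‖ ≤ a) :
    ∫ ω, F (Preorder.frestrictLe n ω) (ω (n + 1)) ∂M.law β κ π ρ =
      ∫ ω, ∫ z, F (Preorder.frestrictLe n ω) z ∂M.drawKernel π (M.next β κ (ω n))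
        ∂M.law β κ π ρ := by
  have hr : Measurable (Preorder.frestrictLe (π := fun _ => EuclideanSpace ℝ (Fin d) × X × Ξ) n) :=
    by fun_prop
  have h : Measurable fun ω : ℕ → EuclideanSpace ℝ (Fin d) × X × Ξ =>
      (Preorder.frestrictLe (π := fun _ => EuclideanSpace ℝ (Fin d) × X × Ξ) n ω, ω (n + 1)) := by
    fun_prop
  have : IsProbabilityMeasure ((M.law β κ π ρ).map (Preorder.frestrictLe
      (π := fun _ => EuclideanSpace ℝ (Fin d) × X × Ξ) n)) :=
    Measure.isProbabilityMeasure_map hr.aemeasurable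
  calc ∫ ω, F (Preorder.frestrictLe n ω) (ω (n + 1)) ∂M.law β κ π ρ
      = ∫ w, Function.uncurry F w ∂((M.law β κ π ρ).map
          fun ω => (Preorder.frestrictLe n ω, ω (n + 1))) :=
        (integral_map h.aemeasurable hF.aestronglyMeasurable).symm
    _ = _ := by
      rw [map_law_succ, Measure.integral_compProd
        (.of_bound hF.aestronglyMeasurable a (ae_of_all _ fun _ => ha _ _)), integral_map
        hr.aemeasurable (hF.integral_kernel_prod_right').aestronglyMeasurable]
      rfl

theorem ae_law_succ_fst (n : ℕ) :
    ∀ᵐ ω ∂M.law β κ π ρ, (ω (n + 1)).1 = M.next β κ (ω n) := by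
  have hs : MeasurableSet {w : ((i : Finset.Iic n) → EuclideanSpace ℝ (Fin d) × X × Ξ) ×
      (EuclideanSpace ℝ (Fin d) × X × Ξ) |
      w.2.1 = M.next β κ (w.1 ⟨n, Finset.mem_Iic.2 le_rfl⟩)} :=
    measurableSet_eq_fun (by fun_prop) ((M.measurable_next β κ).comp (by fun_prop))
  have h : ∀ᵐ w ∂((M.law β κ π ρ).map
      fun ω => (Preorder.frestrictLe n ω, ω (n + 1))),
      w.2.1 = M.next β κ (w.1 ⟨n, Finset.mem_Iic.2 le_rfl⟩) := by
    have : IsProbabilityMeasure ((M.law β κ π ρ).map (Preorder.frestrictLe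
        (π := fun _ => EuclideanSpace ℝ (Fin d) × X × Ξ) n)) :=
      Measure.isProbabilityMeasure_map (by fun_prop)
    rw [map_law_succ, Measure.ae_compProd_iff hs]
    exact ae_of_all _ fun h => M.ae_drawKernel_fst π _
  exact ae_of_ae_map (by fun_prop) h

theorem ae_stateAlong_eq :
    ∀ᵐ ω ∂M.law β κ π ρ, ∀ t, M.stateAlong β ω t κ = (ω t).1 := by
  filter_upwards [ae_all_iff.2 (M.ae_law_succ_fst β κ π ρ)] with ω h t
  induction t with
  | zero => rfl
  | succ t ih =>
    change M.f (M.stateAlong β ω t κ) (ω t).2.1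
      (β.act κ (M.stateAlong β ω t κ) (ω t).2.1) (ω t).2.2 = _
    rw [h, ih]
    rfl

/-- At each time, the discrete action and the disturbance are drawn afresh given the state. -/
theorem integral_law_eval (t : ℕ) {k : EuclideanSpace ℝ (Fin d) × X × Ξ → V}
    (hk : StronglyMeasurable k) {a : ℝ} (ha : ∀ z, ‖k z‖ ≤ a) :
    ∫ ω, k (ω t) ∂M.law β κ π ρ = ∫ ω, ∫ z, k z ∂M.drawKernel π (ω t).1 ∂M.law β κ π ρ := by
  cases t with
  | zero =>
    have h0 : Measurable fun ω : ℕ → EuclideanSpace ℝ (Fin d) × X × Ξ => (ω 0).1 := by fun_prop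
    rw [← integral_map (f := k) (φ := fun ω : ℕ → EuclideanSpace ℝ (Fin d) × X × Ξ => ω 0)
      (measurable_pi_apply 0).aemeasurable hk.aestronglyMeasurable,
      ← integral_map (f := fun s => ∫ z, k z ∂M.drawKernel π s) h0.aemeasurable
        hk.integral_kernel.aestronglyMeasurable, map_law_zero, map_law_zero_fst,
      Measure.comp_eq_comp_const_apply, Kernel.integral_comp]
    · simp
    rw [← Measure.comp_eq_comp_const_apply]
    exact .of_bound hk.aestronglyMeasurable a (ae_of_all _ ha)
  | succ n =>
    rw [M.integral_law_succ β κ π ρ n (F := fun _ z => k z) (hk.comp_measurable measurable_snd)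
      fun _ => ha]
    refine integral_congr_ae ?_
    filter_upwards [M.ae_law_succ_fst β κ π ρ n] with ω h
    rw [h]

end Law

end HybridMDP

/-! ### Value functions, the Bellman equation and optimality -/

theorem norm_integral_le_of_forall_norm_le {α V : Type*} [MeasurableSpace α]
    [NormedAddCommGroup V] [NormedSpace ℝ V] (μ : Measure α) [IsProbabilityMeasure μ]
    {f : α → V} {a : ℝ} (h : ∀ z, ‖f z‖ ≤ a) : ‖∫ z, f z ∂μ‖ ≤ a := by
  simpa using norm_integral_le_of_norm_le_const (μ := μ) (ae_of_all _ h)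

theorem summable_geometric_mul_of_norm_le {γ R : ℝ} (hγ₀ : 0 ≤ γ) (hγ₁ : γ < 1) {u : ℕ → ℝ}
    (hu : ∀ t, ‖u t‖ ≤ R) : Summable fun t => γ ^ t * u t :=
  ((summable_geometric_of_lt_one hγ₀ hγ₁).mul_right R).of_norm_bounded fun t => by
    rw [norm_mul, Real.norm_of_nonneg (pow_nonneg hγ₀ t)]
    exact mul_le_mul_of_nonneg_left (hu t) (pow_nonneg hγ₀ t)

namespace HybridMDP

variable {d p m : ℕ} {X Ξ : Type*} [MeasurableSpace Ξ]

/-- The cost of one step under the continuous component with parameter `κ`, truncated to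
`[-R, R]`. It agrees with the true cost at states in `S`, and unlike the latter it is bounded
everywhere, so that the value functions built from it are bounded and measurable on all of
`ℝ^d`. -/
noncomputable def clampCost (M : HybridMDP d p X Ξ) (β : M.ContinuousPolicy m)
    (κ : EuclideanSpace ℝ (Fin m)) (R : ℝ) (z : EuclideanSpace ℝ (Fin d) × X × Ξ) : ℝ :=
  max (-R) (min R (M.c z.1 z.2.1 (β.act κ z.1 z.2.1) z.2.2))

theorem norm_clampCost_le (M : HybridMDP d p X Ξ) (β : M.ContinuousPolicy m)
    (κ : EuclideanSpace ℝ (Fin m)) {R : ℝ} (hR : 0 ≤ R)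
    (z : EuclideanSpace ℝ (Fin d) × X × Ξ) : ‖M.clampCost β κ R z‖ ≤ R :=
  abs_le.2 ⟨le_max_left _ _, max_le (by linarith) (min_le_left _ _)⟩

theorem clampCost_eq (M : HybridMDP d p X Ξ) (β : M.ContinuousPolicy m)
    (κ : EuclideanSpace ℝ (Fin m)) {R : ℝ}
    (hcost : ∀ s ∈ M.S, ∀ x, ∀ b ∈ M.B x, ∀ ξ, |M.c s x b ξ| ≤ R)
    {z : EuclideanSpace ℝ (Fin d) × X × Ξ} (hz : z.1 ∈ M.S) :
    M.clampCost β κ R z = M.c z.1 z.2.1 (β.act κ z.1 z.2.1) z.2.2 := by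
  have h := abs_le.1 (hcost z.1 hz z.2.1 _ (β.act_mem κ z.1 hz z.2.1) z.2.2)
  rw [clampCost, min_eq_right h.2, max_eq_right h.1]

theorem next_mem (M : HybridMDP d p X Ξ) (β : M.ContinuousPolicy m)
    (κ : EuclideanSpace ℝ (Fin m)) {z : EuclideanSpace ℝ (Fin d) × X × Ξ} (hz : z.1 ∈ M.S) :
    M.next β κ z ∈ M.S :=
  M.f_mem _ hz _ _ (β.act_mem κ _ hz _) _

theorem stateAt_mem (M : HybridMDP d p X Ξ) (β : M.ContinuousPolicy m)
    {s₀ : EuclideanSpace ℝ (Fin d)} (hs : s₀ ∈ M.S) (x : ℕ → X) (ξ : ℕ → Ξ) (t : ℕ)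
    (κ : EuclideanSpace ℝ (Fin m)) : M.stateAt β s₀ x ξ t κ ∈ M.S := by
  induction t with
  | zero => exact hs
  | succ t ih => exact M.f_mem _ ih _ _ (β.act_mem κ _ ih _) _

variable [MeasurableSpace X]

/-- The expected (truncated) cost incurred at time `t` when starting in the state `s`. -/
noncomputable def expCost (M : HybridMDP d p X Ξ) (β : M.ContinuousPolicy m)
    (κ : EuclideanSpace ℝ (Fin m)) (π : DiscretePolicy d X) (R : ℝ) :
    ℕ → EuclideanSpace ℝ (Fin d) → ℝ
  | 0, s => ∫ z, M.clampCost β κ R z ∂M.drawKernel π s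
  | t + 1, s => ∫ z, M.expCost β κ π R t (M.next β κ z) ∂M.drawKernel π s

/-- The value function computed from the truncated cost by summing the expected costs of the
individual time steps. -/
noncomputable def clampValue (M : HybridMDP d p X Ξ) (γ : ℝ) (β : M.ContinuousPolicy m)
    (κ : EuclideanSpace ℝ (Fin m)) (π : DiscretePolicy d X) (R : ℝ)
    (s : EuclideanSpace ℝ (Fin d)) : ℝ :=
  ∑' t : ℕ, γ ^ t * M.expCost β κ π R t s

/-- The action-value function `Q(s, (x, b_κ(s, x)))` computed from the truncated cost. -/
noncomputable def clampActionValue (M : HybridMDP d p X Ξ) (γ : ℝ) (β : M.ContinuousPolicy m)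
    (κ : EuclideanSpace ℝ (Fin m)) (π : DiscretePolicy d X) (R : ℝ)
    (s : EuclideanSpace ℝ (Fin d)) (x : X) : ℝ :=
  ∫ ξ, (M.clampCost β κ R (s, x, ξ) + γ * M.clampValue γ β κ π R (M.next β κ (s, x, ξ))) ∂M.noise

variable (M : HybridMDP d p X Ξ) (β : M.ContinuousPolicy m) (κ : EuclideanSpace ℝ (Fin m))
  (π : DiscretePolicy d X) {R : ℝ} {γ : ℝ}

theorem norm_expCost_le (hR : 0 ≤ R) (t : ℕ) (s : EuclideanSpace ℝ (Fin d)) :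
    ‖M.expCost β κ π R t s‖ ≤ R := by
  induction t generalizing s with
  | zero =>
    exact norm_integral_le_of_forall_norm_le _ (M.norm_clampCost_le β κ hR)
  | succ t ih =>
    exact norm_integral_le_of_forall_norm_le _ fun z => ih (M.next β κ z)

theorem hasSum_clampValue (hγ₀ : 0 ≤ γ) (hγ₁ : γ < 1) (hR : 0 ≤ R)
    (s : EuclideanSpace ℝ (Fin d)) :
    HasSum (fun t => γ ^ t * M.expCost β κ π R t s) (M.clampValue γ β κ π R s) :=
  (summable_geometric_mul_of_norm_le hγ₀ hγ₁ fun t => M.norm_expCost_le β κ π hR t s).hasSum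

theorem norm_clampValue_le (hγ₀ : 0 ≤ γ) (hγ₁ : γ < 1) (hR : 0 ≤ R)
    (s : EuclideanSpace ℝ (Fin d)) : ‖M.clampValue γ β κ π R s‖ ≤ (1 - γ)⁻¹ * R := by
  refine tsum_of_norm_bounded ((hasSum_geometric_of_lt_one hγ₀ hγ₁).mul_right R) fun t => ?_
  rw [norm_mul, Real.norm_of_nonneg (pow_nonneg hγ₀ t)]
  exact mul_le_mul_of_nonneg_left (M.norm_expCost_le β κ π hR t s) (pow_nonneg hγ₀ t)

theorem norm_clampCost_add_le (hγ₀ : 0 ≤ γ) (hγ₁ : γ < 1) (hR : 0 ≤ R)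
    (z : EuclideanSpace ℝ (Fin d) × X × Ξ) :
    ‖M.clampCost β κ R z + γ * M.clampValue γ β κ π R (M.next β κ z)‖ ≤ (1 - γ)⁻¹ * R := by
  have h1 := M.norm_clampCost_le β κ hR z
  have h2 := mul_le_mul_of_nonneg_left
    (M.norm_clampValue_le β κ π hγ₀ hγ₁ hR (M.next β κ z)) hγ₀
  have h3 : R + γ * ((1 - γ)⁻¹ * R) = (1 - γ)⁻¹ * R := by
    have : 1 - γ ≠ 0 := by linarith
    field_simp
    ring
  rw [← h3]
  refine (norm_add_le _ _).trans (add_le_add h1 ?_)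
  rwa [norm_mul, Real.norm_of_nonneg hγ₀]

theorem norm_clampActionValue_le (hγ₀ : 0 ≤ γ) (hγ₁ : γ < 1) (hR : 0 ≤ R)
    (s : EuclideanSpace ℝ (Fin d)) (x : X) :
    ‖M.clampActionValue γ β κ π R s x‖ ≤ (1 - γ)⁻¹ * R :=
  norm_integral_le_of_forall_norm_le _ fun ξ =>
    M.norm_clampCost_add_le β κ π hγ₀ hγ₁ hR (s, x, ξ)

variable [Fintype X] [MeasurableSingletonClass X]

theorem stronglyMeasurable_clampCost (R : ℝ) : StronglyMeasurable (M.clampCost β κ R) := by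
  have h : Measurable fun z : X × (EuclideanSpace ℝ (Fin d) × Ξ) =>
      M.c z.2.1 z.1 (β.act κ z.2.1 z.1) z.2.2 := by
    refine measurable_from_prod_countable_right fun x => ?_
    exact (M.measurable_c x).comp (measurable_fst.prodMk
      (((β.measurable_act κ x).comp measurable_fst).prodMk measurable_snd))
  have h' : Measurable fun z : EuclideanSpace ℝ (Fin d) × X × Ξ =>
      M.c z.1 z.2.1 (β.act κ z.1 z.2.1) z.2.2 :=
    h.comp ((measurable_fst.comp measurable_snd).prodMk
      (measurable_fst.prodMk (measurable_snd.comp measurable_snd)))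
  exact (measurable_const.max (measurable_const.min h')).stronglyMeasurable

theorem stronglyMeasurable_expCost (R : ℝ) (t : ℕ) :
    StronglyMeasurable (M.expCost β κ π R t) := by
  induction t with
  | zero => exact (M.stronglyMeasurable_clampCost β κ R).integral_kernel
  | succ t ih => exact (ih.comp_measurable (M.measurable_next β κ)).integral_kernel

theorem stronglyMeasurable_clampValue (hγ₀ : 0 ≤ γ) (hγ₁ : γ < 1) (hR : 0 ≤ R) :
    StronglyMeasurable (M.clampValue γ β κ π R) := by
  refine stronglyMeasurable_of_tendsto (u := Filter.atTop)
    (f := fun n s => ∑ t ∈ Finset.range n, γ ^ t * M.expCost β κ π R t s) (fun n => ?_) ?_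
  · exact Finset.stronglyMeasurable_fun_sum _ fun t _ =>
      (M.stronglyMeasurable_expCost β κ π R t).const_mul _
  · exact tendsto_pi_nhds.2 fun s =>
      (M.hasSum_clampValue β κ π hγ₀ hγ₁ hR s).tendsto_sum_nat

theorem stronglyMeasurable_clampCost_add (hγ₀ : 0 ≤ γ) (hγ₁ : γ < 1) (hR : 0 ≤ R) :
    StronglyMeasurable fun z =>
      M.clampCost β κ R z + γ * M.clampValue γ β κ π R (M.next β κ z) :=
  (M.stronglyMeasurable_clampCost β κ R).add
    (((M.stronglyMeasurable_clampValue β κ π hγ₀ hγ₁ hR).comp_measurable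
      (M.measurable_next β κ)).const_mul γ)

theorem measurable_clampActionValue (hγ₀ : 0 ≤ γ) (hγ₁ : γ < 1) (hR : 0 ≤ R) :
    Measurable fun w : EuclideanSpace ℝ (Fin d) × X => M.clampActionValue γ β κ π R w.1 w.2 := by
  have h := (M.stronglyMeasurable_clampCost_add β κ π hγ₀ hγ₁ hR).comp_measurable
    (MeasurableEquiv.prodAssoc (α := EuclideanSpace ℝ (Fin d)) (β := X) (γ := Ξ)).measurable
  exact (h.integral_prod_right' (ν := M.noise)).measurable

/-- The Bellman equation for the policy `π`; thanks to the truncation it holds at every `s`. -/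
theorem clampValue_eq_sum (hγ₀ : 0 ≤ γ) (hγ₁ : γ < 1) (hR : 0 ≤ R)
    (s : EuclideanSpace ℝ (Fin d)) :
    M.clampValue γ β κ π R s = ∑ x, π.prob x s * M.clampActionValue γ β κ π R s x := by
  have hint : ∀ t, Integrable (fun z => γ ^ t * M.expCost β κ π R t (M.next β κ z))
      (M.drawKernel π s) := fun t =>
    (Integrable.of_bound ((M.stronglyMeasurable_expCost β κ π R t).comp_measurable
      (M.measurable_next β κ)).aestronglyMeasurable R
      (ae_of_all _ fun z => M.norm_expCost_le β κ π hR t _)).const_mul _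
  have hsum : Summable fun t =>
      ∫ z, ‖γ ^ t * M.expCost β κ π R t (M.next β κ z)‖ ∂M.drawKernel π s := by
    simp_rw [norm_mul, integral_const_mul, Real.norm_of_nonneg (pow_nonneg hγ₀ _)]
    refine summable_geometric_mul_of_norm_le (R := R) hγ₀ hγ₁ fun t => ?_
    exact norm_integral_le_of_forall_norm_le _ fun z => (norm_norm _).trans_le
      (M.norm_expCost_le β κ π hR t (M.next β κ z))
  have htail : ∑' t, γ ^ t * M.expCost β κ π R (t + 1) s =
      ∫ z, M.clampValue γ β κ π R (M.next β κ z) ∂M.drawKernel π s := by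
    unfold clampValue
    rw [← integral_tsum_of_summable_integral_norm hint hsum]
    simp_rw [integral_const_mul]
    rfl
  have hcont : Integrable (fun z => M.clampValue γ β κ π R (M.next β κ z))
      (M.drawKernel π s) :=
    .of_bound ((M.stronglyMeasurable_clampValue β κ π hγ₀ hγ₁ hR).comp_measurable
      (M.measurable_next β κ)).aestronglyMeasurable _
      (ae_of_all _ fun z => M.norm_clampValue_le β κ π hγ₀ hγ₁ hR _)
  have hc : Integrable (M.clampCost β κ R) (M.drawKernel π s) :=
    .of_bound (M.stronglyMeasurable_clampCost β κ R).aestronglyMeasurable _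
      (ae_of_all _ (M.norm_clampCost_le β κ hR))
  calc M.clampValue γ β κ π R s
      = M.expCost β κ π R 0 s + γ * ∑' t, γ ^ t * M.expCost β κ π R (t + 1) s := by
        rw [clampValue, (M.hasSum_clampValue β κ π hγ₀ hγ₁ hR s).summable.tsum_eq_zero_add,
          ← tsum_mul_left]
        simp [pow_succ', mul_assoc]
    _ = ∫ z, (M.clampCost β κ R z + γ * M.clampValue γ β κ π R (M.next β κ z))
          ∂M.drawKernel π s := by
        rw [htail, integral_add hc (hcont.const_mul γ), integral_const_mul]
        rfl
    _ = _ := by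
        rw [M.integral_drawKernel π s (M.stronglyMeasurable_clampCost_add β κ π hγ₀ hγ₁ hR)
          (M.norm_clampCost_add_le β κ π hγ₀ hγ₁ hR)]
        rfl

section Law

variable (ρ : Measure (EuclideanSpace ℝ (Fin d))) [IsProbabilityMeasure ρ]

theorem ae_law_mem (hρ : ∀ᵐ s ∂ρ, s ∈ M.S) :
    ∀ᵐ ω ∂M.law β κ π ρ, ∀ t, (ω t).1 ∈ M.S := by
  have h0 : ∀ᵐ ω ∂M.law β κ π ρ, (ω 0).1 ∈ M.S := by
    refine ae_of_ae_map (p := fun s => s ∈ M.S) (measurable_pi_apply 0).fst.aemeasurable ?_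
    rwa [map_law_zero_fst]
  filter_upwards [h0, ae_all_iff.2 (M.ae_law_succ_fst β κ π ρ)] with ω h0 h t
  induction t with
  | zero => exact h0
  | succ t ih => rw [h]; exact M.next_mem β κ ih

theorem ae_map_law_mem (hρ : ∀ᵐ s ∂ρ, s ∈ M.S) (t : ℕ) :
    ∀ᵐ s ∂(M.law β κ π ρ).map (fun ω => (ω t).1), s ∈ M.S := by
  have hs : Measurable fun ω : ℕ → EuclideanSpace ℝ (Fin d) × X × Ξ => (ω t).1 :=
    (measurable_pi_apply t).fst
  refine (ae_map_iff (p := fun s => s ∈ M.S) hs.aemeasurable M.measurableSet_S).2 ?_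
  filter_upwards [M.ae_law_mem β κ π ρ hρ] with ω h using h t

/-- Moving one step back in time turns the expected cost `k` steps ahead into the one `k + 1`
steps ahead, down to the initial distribution. -/
theorem integral_law_expCost (hR : 0 ≤ R) (t k : ℕ) :
    ∫ ω, M.expCost β κ π R k (ω t).1 ∂M.law β κ π ρ = ∫ s, M.expCost β κ π R (k + t) s ∂ρ := by
  induction t generalizing k with
  | zero =>
    have h := integral_map (μ := M.law β κ π ρ)
      (φ := fun ω : ℕ → EuclideanSpace ℝ (Fin d) × X × Ξ => (ω 0).1)
      (measurable_pi_apply 0).fst.aemeasurable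
      (M.stronglyMeasurable_expCost β κ π R k).aestronglyMeasurable
    rw [map_law_zero_fst] at h
    exact h.symm
  | succ t ih =>
    calc ∫ ω, M.expCost β κ π R k (ω (t + 1)).1 ∂M.law β κ π ρ
        = ∫ ω, M.expCost β κ π R k (M.next β κ (ω t)) ∂M.law β κ π ρ := by
          refine integral_congr_ae ?_
          filter_upwards [M.ae_law_succ_fst β κ π ρ t] with ω h
          rw [h]
      _ = ∫ ω, M.expCost β κ π R (k + 1) (ω t).1 ∂M.law β κ π ρ :=
          M.integral_law_eval β κ π ρ t (k := fun z => M.expCost β κ π R k (M.next β κ z))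
            ((M.stronglyMeasurable_expCost β κ π R k).comp_measurable (M.measurable_next β κ))
            fun z => M.norm_expCost_le β κ π hR k _
      _ = _ := by rw [ih, add_assoc, add_comm 1 t]

theorem integral_law_clampCost (hR : 0 ≤ R) (t : ℕ) :
    ∫ ω, M.clampCost β κ R (ω t) ∂M.law β κ π ρ = ∫ s, M.expCost β κ π R t s ∂ρ := by
  rw [M.integral_law_eval β κ π ρ t (M.stronglyMeasurable_clampCost β κ R)
    (M.norm_clampCost_le β κ hR)]
  exact (M.integral_law_expCost β κ π ρ hR t 0).trans (by rw [zero_add])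

end Law

/-- On `S` the value function of the trajectory law is the one built from the truncated cost. -/
theorem value_eq (hγ₀ : 0 ≤ γ) (hγ₁ : γ < 1) (hR : 0 ≤ R)
    (hcost : ∀ s ∈ M.S, ∀ x, ∀ b ∈ M.B x, ∀ ξ, |M.c s x b ξ| ≤ R)
    {s : EuclideanSpace ℝ (Fin d)} (hs : s ∈ M.S) :
    M.value γ β κ π s = M.clampValue γ β κ π R s := by
  have hint : ∀ t, Integrable (fun ω : ℕ → EuclideanSpace ℝ (Fin d) × X × Ξ =>
      γ ^ t * M.clampCost β κ R (ω t)) (M.law β κ π (Measure.dirac s)) := fun t =>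
    (Integrable.of_bound ((M.stronglyMeasurable_clampCost β κ R).comp_measurable
      (measurable_pi_apply t)).aestronglyMeasurable R
      (ae_of_all _ fun z => M.norm_clampCost_le β κ hR _)).const_mul _
  have hsum : Summable fun t =>
      ∫ ω, ‖γ ^ t * M.clampCost β κ R (ω t)‖ ∂M.law β κ π (Measure.dirac s) := by
    simp_rw [norm_mul, integral_const_mul, Real.norm_of_nonneg (pow_nonneg hγ₀ _)]
    refine summable_geometric_mul_of_norm_le (R := R) hγ₀ hγ₁ fun t => ?_
    exact norm_integral_le_of_forall_norm_le _ fun ω => (norm_norm _).trans_le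
      (M.norm_clampCost_le β κ hR (ω t))
  calc M.value γ β κ π s
      = ∫ ω, ∑' t : ℕ, γ ^ t * M.clampCost β κ R (ω t) ∂M.law β κ π (Measure.dirac s) := by
        refine integral_congr_ae ?_
        filter_upwards [M.ae_stateAlong_eq β κ π (Measure.dirac s),
          M.ae_law_mem β κ π (Measure.dirac s)
            ((ae_dirac_iff M.measurableSet_S).2 hs)] with ω h1 h2
        refine tsum_congr fun t => ?_
        rw [h1, M.clampCost_eq β κ hcost (h2 t)]
    _ = _ := by
        rw [← integral_tsum_of_summable_integral_norm hint hsum, clampValue]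
        simp_rw [integral_const_mul, M.integral_law_clampCost β κ π _ hR, integral_dirac]

theorem actionValue_eq (hγ₀ : 0 ≤ γ) (hγ₁ : γ < 1) (hR : 0 ≤ R)
    (hcost : ∀ s ∈ M.S, ∀ x, ∀ b ∈ M.B x, ∀ ξ, |M.c s x b ξ| ≤ R)
    {s : EuclideanSpace ℝ (Fin d)} (hs : s ∈ M.S) (x : X) :
    M.actionValue γ β κ π s x (β.act κ s x) = M.clampActionValue γ β κ π R s x := by
  refine integral_congr_ae (ae_of_all _ fun ξ => ?_)
  have h := M.value_eq β κ π hγ₀ hγ₁ hR hcost (M.next_mem β κ (z := (s, x, ξ)) hs)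
  simp only [next] at h
  simp only [M.clampCost_eq β κ hcost (z := (s, x, ξ)) hs, h, next]

/-- A bound on the difference of two value functions on `S` passes to the action values, with a
factor `γ`. -/
theorem clampActionValue_sub_le {π' : DiscretePolicy d X} {a : ℝ} (hγ₀ : 0 ≤ γ) (hγ₁ : γ < 1)
    (hR : 0 ≤ R)
    (h : ∀ s ∈ M.S, M.clampValue γ β κ π R s - M.clampValue γ β κ π' R s ≤ a)
    {s : EuclideanSpace ℝ (Fin d)} (hs : s ∈ M.S) (x : X) :
    M.clampActionValue γ β κ π R s x - M.clampActionValue γ β κ π' R s x ≤ γ * a := by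
  have hint (π : DiscretePolicy d X) : Integrable (fun ξ => M.clampCost β κ R (s, x, ξ) +
      γ * M.clampValue γ β κ π R (M.next β κ (s, x, ξ))) M.noise :=
    .of_bound ((M.stronglyMeasurable_clampCost_add β κ π hγ₀ hγ₁ hR).comp_measurable
      (by fun_prop : Measurable fun ξ : Ξ => (s, x, ξ))).aestronglyMeasurable _
      (ae_of_all _ fun ξ => M.norm_clampCost_add_le β κ π hγ₀ hγ₁ hR _)
  rw [clampActionValue, clampActionValue, ← integral_sub (hint π) (hint π')]
  calc _ ≤ ∫ _, γ * a ∂M.noise := by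
        refine integral_mono ((hint π).sub (hint π')) (integrable_const _) fun ξ => ?_
        have := mul_le_mul_of_nonneg_left (h _ (M.next_mem β κ (z := (s, x, ξ)) hs)) hγ₀
        simp only
        linarith
    _ = γ * a := by simp

/-- The optimality inequality `V*(s) ≤ Q*(s, x)`: deviating to the action `x` in the single
state `s` does not improve a statewise best response. -/
theorem IsStatewiseBestResponse.clampValue_le_clampActionValue {M : HybridMDP d p X Ξ}
    {β : M.ContinuousPolicy m} {κ : EuclideanSpace ℝ (Fin m)} {π : DiscretePolicy d X}
    (hπ : M.IsStatewiseBestResponse γ β κ π) (hγ₀ : 0 ≤ γ) (hγ₁ : γ < 1) (hR : 0 ≤ R)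
    (hcost : ∀ s ∈ M.S, ∀ x, ∀ b ∈ M.B x, ∀ ξ, |M.c s x b ξ| ≤ R)
    {s : EuclideanSpace ℝ (Fin d)} (hs : s ∈ M.S) (x : X) :
    M.clampValue γ β κ π R s ≤ M.clampActionValue γ β κ π R s x := by
  classical
  by_contra! hlt
  have := π.isMarkovKernel_kernel
  -- the policy that plays `x` in the state `s` and follows `π` elsewhere
  let π' : DiscretePolicy d X :=
    ⟨Kernel.piecewise (measurableSet_singleton s) (Kernel.const _ (Measure.dirac x)) π.kernel,
      inferInstance⟩
  have hself : ∀ F : X → ℝ, ∑ y, π'.prob y s * F y = F x := by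
    intro F
    have : ∀ y, π'.prob y s = if y = x then 1 else 0 := by
      intro y
      by_cases h : y = x
      · simp [π', DiscretePolicy.prob, Kernel.piecewise_apply, measureReal_def, h]
      · simp [π', DiscretePolicy.prob, Kernel.piecewise_apply, measureReal_def, h, Ne.symm h]
    simp [this]
  have hother : ∀ s' ≠ s, ∀ y, π'.prob y s' = π.prob y s' := by
    intro s' hs' y
    simp [π', DiscretePolicy.prob, Kernel.piecewise_apply, hs']
  -- a contraction argument shows that the deviation does not increase the value
  have hpow : ∀ n : ℕ, ∀ s' ∈ M.S, M.clampValue γ β κ π' R s' - M.clampValue γ β κ π R s' ≤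
      γ ^ n * (2 * ((1 - γ)⁻¹ * R)) := by
    intro n
    induction n with
    | zero =>
      intro s' _
      have h1 := abs_le.1 (M.norm_clampValue_le β κ π hγ₀ hγ₁ hR s')
      have h2 := abs_le.1 (M.norm_clampValue_le β κ π' hγ₀ hγ₁ hR s')
      linarith
    | succ n ih =>
      intro s' hs'
      have hQ := fun y => M.clampActionValue_sub_le β κ π' hγ₀ hγ₁ hR ih hs' y
      rw [pow_succ', mul_assoc]
      rw [M.clampValue_eq_sum β κ π' hγ₀ hγ₁ hR]
      by_cases h : s' = s
      · subst h
        rw [hself]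
        linarith [hQ x]
      · rw [M.clampValue_eq_sum β κ π hγ₀ hγ₁ hR, ← Finset.sum_sub_distrib]
        simp_rw [hother s' h, ← mul_sub]
        exact π.sum_prob_mul_le s' hQ
  have hle : ∀ s' ∈ M.S, M.clampValue γ β κ π' R s' - M.clampValue γ β κ π R s' ≤ 0 := by
    intro s' hs'
    have hlim := (tendsto_pow_atTop_nhds_zero_of_lt_one hγ₀ hγ₁).mul_const
      (2 * ((1 - γ)⁻¹ * R))
    rw [zero_mul] at hlim
    exact ge_of_tendsto' hlim fun n => hpow n s' hs'
  have h1 := M.clampActionValue_sub_le β κ π' hγ₀ hγ₁ hR hle hs x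
  have h2 := hπ s hs π'
  rw [M.value_eq β κ π hγ₀ hγ₁ hR hcost hs, M.value_eq β κ π' hγ₀ hγ₁ hR hcost hs,
    M.clampValue_eq_sum β κ π' hγ₀ hγ₁ hR, hself] at h2
  linarith

/-- The value of a statewise best response is a lower bound for the action values of every
policy. -/
theorem IsStatewiseBestResponse.clampValue_le {M : HybridMDP d p X Ξ}
    {β : M.ContinuousPolicy m} {κ : EuclideanSpace ℝ (Fin m)} {π : DiscretePolicy d X}
    (hπ : M.IsStatewiseBestResponse γ β κ π) (hγ₀ : 0 ≤ γ) (hγ₁ : γ < 1) (hR : 0 ≤ R)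
    (hcost : ∀ s ∈ M.S, ∀ x, ∀ b ∈ M.B x, ∀ ξ, |M.c s x b ξ| ≤ R) (π' : DiscretePolicy d X)
    {s : EuclideanSpace ℝ (Fin d)} (hs : s ∈ M.S) (x : X) :
    M.clampValue γ β κ π R s ≤ M.clampActionValue γ β κ π' R s x := by
  have h := M.clampActionValue_sub_le β κ π (π' := π') (a := 0) hγ₀ hγ₁ hR (fun s' hs' => by
    rw [← M.value_eq β κ π hγ₀ hγ₁ hR hcost hs', ← M.value_eq β κ π' hγ₀ hγ₁ hR hcost hs']
    linarith [hπ s' hs' π']) hs x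
  linarith [hπ.clampValue_le_clampActionValue hγ₀ hγ₁ hR hcost hs x]

end HybridMDP

/-! ### Gradients: chain rule, measurability and mean zero of the score -/

/-- The chain rule for gradients, with the outer function only differentiable within a set that
contains the range of the inner one. The gradient `g` of the outer function need not be unique. -/
theorem HasGradientWithinAt.hasGradientAt_comp {E F : Type*} [NormedAddCommGroup E]
    [InnerProductSpace ℝ E] [CompleteSpace E] [NormedAddCommGroup F] [InnerProductSpace ℝ F]
    [CompleteSpace F] {f : F → ℝ} {g : F} {S : Set F} {σ : E → F} {κ : E}
    (hf : HasGradientWithinAt f g S (σ κ)) (hσ : DifferentiableAt ℝ σ κ) (hS : ∀ κ', σ κ' ∈ S) :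
    HasGradientAt (fun κ' => f (σ κ')) (ContinuousLinearMap.adjoint (fderiv ℝ σ κ) g) κ := by
  rw [hasGradientAt_iff_hasFDerivAt]
  have h := (hasGradientWithinAt_iff_hasFDerivWithinAt.1 hf).comp_hasFDerivAt κ hσ.hasFDerivAt
    (Filter.Eventually.of_forall hS)
  convert! h using 1
  ext v
  simp [ContinuousLinearMap.adjoint_inner_left]

/-- The gradient at a fixed point of a family of functions is measurable in the parameter: it is
a limit of difference quotients at countably many points. -/
theorem measurable_indicator_gradient {m : ℕ} {Ω : Type*} [MeasurableSpace Ω] {A : Set Ω}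
    (hA : MeasurableSet A) {L : Ω → EuclideanSpace ℝ (Fin m) → ℝ}
    {κ : EuclideanSpace ℝ (Fin m)} (hL : ∀ κ', Measurable fun ω => L ω κ')
    (hd : ∀ ω ∈ A, DifferentiableAt ℝ (L ω) κ) :
    Measurable (A.indicator fun ω => gradient (L ω) κ) := by
  let b := EuclideanSpace.basisFun (Fin m) ℝ
  have hcoord : ∀ i, Measurable (A.indicator fun ω => fderiv ℝ (L ω) κ (b i)) := by
    intro i
    refine measurable_of_tendsto_metrizable
      (f := fun n : ℕ => A.indicator fun ω => (n : ℝ) • (L ω (κ + (n : ℝ)⁻¹ • b i) - L ω κ))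
      (fun n => (((hL _).sub (hL κ)).const_smul (n : ℝ)).indicator hA) ?_
    refine tendsto_pi_nhds.2 fun ω => ?_
    by_cases hω : ω ∈ A
    · simp only [Set.indicator_of_mem hω]
      exact ((hd ω hω).hasFDerivAt.lim_real (b i)).comp tendsto_natCast_atTop_atTop
    · simp [Set.indicator_of_notMem hω]
  have heq : (A.indicator fun ω => gradient (L ω) κ) =
      fun ω => ∑ i, (A.indicator (fun ω => fderiv ℝ (L ω) κ (b i)) ω) • b i := by
    funext ω
    by_cases hω : ω ∈ A
    · simp only [Set.indicator_of_mem hω]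
      rw [← b.sum_repr' (gradient (L ω) κ)]
      refine Finset.sum_congr rfl fun i _ => ?_
      rw [real_inner_comm, gradient, InnerProductSpace.toDual_symm_apply]
    · simp [Set.indicator_of_notMem hω]
  rw [heq]
  exact Finset.measurable_fun_sum _ fun i _ => (hcoord i).smul_const _

/-- The scores of a differentiable family of probability vectors have mean zero. -/
theorem sum_smul_eq_zero_of_hasGradientAt_log {E X : Type*} [NormedAddCommGroup E]
    [InnerProductSpace ℝ E] [CompleteSpace E] [Fintype X] {P : X → E → ℝ} {g : X → E} {κ : E}
    (hpos : ∀ x κ', 0 < P x κ') (hsum : ∀ κ', ∑ x, P x κ' = 1)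
    (hg : ∀ x, HasGradientAt (fun κ' => Real.log (P x κ')) (g x) κ) :
    ∑ x, P x κ • g x = 0 := by
  have h : ∀ x, HasFDerivAt (P x) (P x κ • InnerProductSpace.toDual ℝ E (g x)) κ := by
    intro x
    have := (hasGradientAt_iff_hasFDerivAt.1 (hg x)).exp
    simpa only [Real.exp_log (hpos x _)] using this
  have h1 : HasFDerivAt (fun κ' => ∑ x, P x κ')
      (∑ x, P x κ • InnerProductSpace.toDual ℝ E (g x)) κ :=
    HasFDerivAt.fun_sum fun x _ => h x
  simp_rw [hsum] at h1
  have h2 := h1.unique (hasFDerivAt_const (1 : ℝ) κ)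
  apply (InnerProductSpace.toDual ℝ E).injective
  simpa using h2

namespace HybridMDP

variable {d p m : ℕ} {X Ξ : Type*} [MeasurableSpace Ξ]

theorem stateAlong_congr (M : HybridMDP d p X Ξ) (β : M.ContinuousPolicy m)
    {ω ω' : ℕ → EuclideanSpace ℝ (Fin d) × X × Ξ} (h0 : ω 0 = ω' 0) {t : ℕ}
    (h : ∀ i < t, ω i = ω' i) : M.stateAlong β ω t = M.stateAlong β ω' t := by
  funext κ
  induction t with
  | zero => exact congrArg Prod.fst h0
  | succ t ih =>
    have ih := ih fun i hi => h i (hi.trans t.lt_succ_self)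
    unfold stateAlong at ih ⊢
    simp only [stateAt, ih, h t t.lt_succ_self]

variable [MeasurableSpace X]

/-- The score `∇_κ log π(x | s_t(κ))` of the discrete action `x` at time `t`, set to zero on the
trajectories whose initial state lies outside `A`. For a suitable measurable set `A` of full
measure this makes it measurable and bounded on the whole trajectory space. -/
noncomputable def score (M : HybridMDP d p X Ξ) (β : M.ContinuousPolicy m)
    (κ : EuclideanSpace ℝ (Fin m)) (π : DiscretePolicy d X) (A : Set (EuclideanSpace ℝ (Fin d)))
    (t : ℕ) (x : X) : (ℕ → EuclideanSpace ℝ (Fin d) × X × Ξ) → EuclideanSpace ℝ (Fin m) :=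
  {ω | (ω 0).1 ∈ A}.indicator
    fun ω => gradient (fun κ' => Real.log (π.prob x (M.stateAlong β ω t κ'))) κ

/-- The weight `q(s_t, x_t)` times the score of the action `x_t`, at time `t` of a trajectory.
The undiscounted summand of the cross term is the case where `q` is the action value; baselines
are handled by varying `q`. -/
noncomputable def scoreTerm (M : HybridMDP d p X Ξ) (β : M.ContinuousPolicy m)
    (κ : EuclideanSpace ℝ (Fin m)) (π : DiscretePolicy d X) (A : Set (EuclideanSpace ℝ (Fin d)))
    (t : ℕ) (q : EuclideanSpace ℝ (Fin d) × X → ℝ)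
    (ω : ℕ → EuclideanSpace ℝ (Fin d) × X × Ξ) : EuclideanSpace ℝ (Fin m) :=
  q ((ω t).1, (ω t).2.1) • M.score β κ π A t (ω t).2.1 ω

theorem score_zero (M : HybridMDP d p X Ξ) (β : M.ContinuousPolicy m)
    (κ : EuclideanSpace ℝ (Fin m)) (π : DiscretePolicy d X) (A : Set (EuclideanSpace ℝ (Fin d)))
    (x : X) : M.score β κ π A 0 x = 0 := by
  have h : ∀ ω : ℕ → EuclideanSpace ℝ (Fin d) × X × Ξ,
      gradient (fun κ' => Real.log (π.prob x (M.stateAlong β ω 0 κ'))) κ = 0 :=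
    fun ω => gradient_const κ (Real.log (π.prob x (ω 0).1))
  funext ω
  simp [score, h]

/-- The score at time `t` depends only on the initial state and the trajectory before time `t`. -/
theorem score_congr (M : HybridMDP d p X Ξ) (β : M.ContinuousPolicy m)
    (κ : EuclideanSpace ℝ (Fin m)) (π : DiscretePolicy d X) (A : Set (EuclideanSpace ℝ (Fin d)))
    (x : X) {ω ω' : ℕ → EuclideanSpace ℝ (Fin d) × X × Ξ} (h0 : ω 0 = ω' 0) {t : ℕ}
    (h : ∀ i < t, ω i = ω' i) : M.score β κ π A t x ω = M.score β κ π A t x ω' := by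
  classical
  simp only [score, Set.indicator_apply, Set.mem_ofPred_eq, h0, M.stateAlong_congr β h0 h]

/-- The sensitivity assumptions at the fixed parameter `κ` and policy `π`, with the state bound
required at every (not just almost every) initial state of a measurable set `A ⊆ S`. -/
structure SensitiveOn (M : HybridMDP d p X Ξ) (β : M.ContinuousPolicy m)
    (κ : EuclideanSpace ℝ (Fin m)) (π : DiscretePolicy d X) (A : Set (EuclideanSpace ℝ (Fin d)))
    (Lπ Ls : ℝ) : Prop where
  measurableSet : MeasurableSet A
  subset : A ⊆ M.S
  state : ∀ s₀ ∈ A, ∀ (x : ℕ → X) (ξ : ℕ → Ξ) (t : ℕ), 1 ≤ t →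
    DifferentiableAt ℝ (M.stateAt β s₀ x ξ t) κ ∧ ‖fderiv ℝ (M.stateAt β s₀ x ξ t) κ‖ ≤ Ls
  pos : ∀ x, ∀ s ∈ M.S, 0 < π.prob x s
  gradient : ∀ x, ∀ s ∈ M.S, ∃ g : EuclideanSpace ℝ (Fin d),
    HasGradientWithinAt (fun s' => Real.log (π.prob x s')) g M.S s ∧ ‖g‖ ≤ Lπ
  nonneg_left : 0 ≤ Lπ
  nonneg_right : 0 ≤ Ls

namespace SensitiveOn

variable {M : HybridMDP d p X Ξ} {β : M.ContinuousPolicy m} {κ : EuclideanSpace ℝ (Fin m)}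
  {π : DiscretePolicy d X} {A : Set (EuclideanSpace ℝ (Fin d))} {Lπ Ls : ℝ}

theorem hasGradientAt (h : M.SensitiveOn β κ π A Lπ Ls) (t : ℕ) (x : X)
    {ω : ℕ → EuclideanSpace ℝ (Fin d) × X × Ξ} (hω : (ω 0).1 ∈ A) :
    HasGradientAt (fun κ' => Real.log (π.prob x (M.stateAlong β ω t κ')))
      (M.score β κ π A t x ω) κ ∧ ‖M.score β κ π A t x ω‖ ≤ Lπ * Ls := by
  rcases Nat.eq_zero_or_pos t with rfl | ht
  · rw [score_zero]
    exact ⟨hasGradientAt_const κ (Real.log (π.prob x (ω 0).1)),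
      by simpa using mul_nonneg h.nonneg_left h.nonneg_right⟩
  obtain ⟨hd, hn⟩ := h.state _ hω (fun i => (ω i).2.1) (fun i => (ω i).2.2) t ht
  have hS := M.stateAt_mem β (h.subset hω) (fun i => (ω i).2.1) (fun i => (ω i).2.2) t
  obtain ⟨g, hg, hgn⟩ := h.gradient x _ (hS κ)
  have hgrad := hg.hasGradientAt_comp hd hS
  have heq : M.score β κ π A t x ω =
      ContinuousLinearMap.adjoint (fderiv ℝ (M.stateAlong β ω t) κ) g := by
    rw [score, Set.indicator_of_mem (by exact hω)]
    exact hgrad.gradient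
  rw [heq]
  refine ⟨hgrad, (ContinuousLinearMap.le_opNorm _ _).trans ?_⟩
  rw [LinearIsometryEquiv.norm_map, mul_comm]
  exact mul_le_mul hgn hn (norm_nonneg _) h.nonneg_left

theorem norm_score_le (h : M.SensitiveOn β κ π A Lπ Ls) (t : ℕ) (x : X)
    (ω : ℕ → EuclideanSpace ℝ (Fin d) × X × Ξ) : ‖M.score β κ π A t x ω‖ ≤ Lπ * Ls := by
  by_cases hω : (ω 0).1 ∈ A
  · exact (h.hasGradientAt t x hω).2
  · rw [score, Set.indicator_of_notMem (by exact hω), norm_zero]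
    exact mul_nonneg h.nonneg_left h.nonneg_right

theorem norm_scoreTerm_le (h : M.SensitiveOn β κ π A Lπ Ls) (t : ℕ)
    (q : EuclideanSpace ℝ (Fin d) × X → ℝ) (ω : ℕ → EuclideanSpace ℝ (Fin d) × X × Ξ) :
    ‖M.scoreTerm β κ π A t q ω‖ ≤ |q ((ω t).1, (ω t).2.1)| * (Lπ * Ls) := by
  rw [scoreTerm, norm_smul, Real.norm_eq_abs]
  exact mul_le_mul_of_nonneg_left (h.norm_score_le t _ ω) (abs_nonneg _)

variable [Fintype X] [MeasurableSingletonClass X]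

/-- Given the past, the score of the freshly drawn action has mean zero. Off `A` all scores are
zero by convention. -/
theorem sum_prob_smul_score (h : M.SensitiveOn β κ π A Lπ Ls) (t : ℕ)
    (ω : ℕ → EuclideanSpace ℝ (Fin d) × X × Ξ) :
    ∑ x, π.prob x (M.stateAlong β ω t κ) • M.score β κ π A t x ω = 0 := by
  by_cases hω : (ω 0).1 ∈ A
  · exact sum_smul_eq_zero_of_hasGradientAt_log
      (P := fun x κ' => π.prob x (M.stateAlong β ω t κ'))
      (fun x κ' => h.pos x _ (M.stateAt_mem β (h.subset hω) _ _ t κ')) (fun _ => π.sum_prob _)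
      fun x => (h.hasGradientAt t x hω).1
  · refine Finset.sum_eq_zero fun x _ => ?_
    rw [score, Set.indicator_of_notMem (by exact hω), smul_zero]

end SensitiveOn

variable [Fintype X] [MeasurableSingletonClass X]

theorem measurable_stateAlong (M : HybridMDP d p X Ξ) (β : M.ContinuousPolicy m) (t : ℕ)
    (κ : EuclideanSpace ℝ (Fin m)) : Measurable fun ω => M.stateAlong β ω t κ := by
  induction t with
  | zero => exact (measurable_pi_apply 0).fst
  | succ t ih => exact (M.measurable_next β κ).comp (ih.prodMk (measurable_pi_apply t).snd)

namespace SensitiveOn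

variable {M : HybridMDP d p X Ξ} {β : M.ContinuousPolicy m} {κ : EuclideanSpace ℝ (Fin m)}
  {π : DiscretePolicy d X} {A : Set (EuclideanSpace ℝ (Fin d))} {Lπ Ls : ℝ}

theorem measurable_score (h : M.SensitiveOn β κ π A Lπ Ls) (t : ℕ) {α : Type*}
    [MeasurableSpace α] {u : α → X} {v : α → ℕ → EuclideanSpace ℝ (Fin d) × X × Ξ}
    (hu : Measurable u) (hv : Measurable v) :
    Measurable fun a => M.score β κ π A t (u a) (v a) := by
  have hjoint : Measurable fun w : X × (ℕ → EuclideanSpace ℝ (Fin d) × X × Ξ) =>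
      M.score β κ π A t w.1 w.2 := by
    refine measurable_from_prod_countable_right fun x => ?_
    have hA : MeasurableSet {ω : ℕ → EuclideanSpace ℝ (Fin d) × X × Ξ | (ω 0).1 ∈ A} :=
      (measurable_pi_apply 0).fst h.measurableSet
    have hL : ∀ κ', Measurable fun ω => Real.log (π.prob x (M.stateAlong β ω t κ')) :=
      fun κ' => ((π.measurable_prob x).comp (M.measurable_stateAlong β t κ')).log
    have hd : ∀ ω ∈ {ω : ℕ → EuclideanSpace ℝ (Fin d) × X × Ξ | (ω 0).1 ∈ A},
      DifferentiableAt ℝ (fun κ' => Real.log (π.prob x (M.stateAlong β ω t κ'))) κ :=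
      fun ω hω => (h.hasGradientAt t x hω).1.differentiableAt
    exact measurable_indicator_gradient hA hL hd
  have hcomp := hjoint.comp (hu.prodMk hv)
  exact hcomp

theorem measurable_scoreTerm (h : M.SensitiveOn β κ π A Lπ Ls) (t : ℕ)
    {q : EuclideanSpace ℝ (Fin d) × X → ℝ} (hq : Measurable q) :
    Measurable (M.scoreTerm β κ π A t q) := by
  have hx : Measurable fun ω : ℕ → EuclideanSpace ℝ (Fin d) × X × Ξ => (ω t).2.1 :=
    (measurable_pi_apply t).snd.fst
  have hs : Measurable fun ω : ℕ → EuclideanSpace ℝ (Fin d) × X × Ξ => (ω t).1 :=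
    (measurable_pi_apply t).fst
  have h1 := h.measurable_score t hx measurable_id
  have h2 := hq.comp (hs.prodMk hx)
  exact Measurable.smul h2 h1

theorem integrable_scoreTerm (h : M.SensitiveOn β κ π A Lπ Ls) (t : ℕ)
    {q : EuclideanSpace ℝ (Fin d) × X → ℝ} (hq : Measurable q) {a : ℝ} (ha : ∀ w, |q w| ≤ a)
    (μ : Measure (ℕ → EuclideanSpace ℝ (Fin d) × X × Ξ)) [IsFiniteMeasure μ] :
    Integrable (M.scoreTerm β κ π A t q) μ :=
  .of_bound (h.measurable_scoreTerm t hq).aestronglyMeasurable (a * (Lπ * Ls))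
    (ae_of_all _ fun ω => (h.norm_scoreTerm_le t q ω).trans
      (mul_le_mul_of_nonneg_right (ha _) (mul_nonneg h.nonneg_left h.nonneg_right)))

/-- A baseline that depends on the current state only does not contribute to the cross term. -/
theorem integral_scoreTerm_eq_zero (h : M.SensitiveOn β κ π A Lπ Ls)
    (ρ : Measure (EuclideanSpace ℝ (Fin d))) [IsProbabilityMeasure ρ] (n : ℕ)
    {w : EuclideanSpace ℝ (Fin d) → ℝ} (hw : Measurable w) {a : ℝ} (ha : ∀ s, |w s| ≤ a) :
    ∫ ω, M.scoreTerm β κ π A (n + 1) (fun v => w v.1) ω ∂M.law β κ π ρ = 0 := by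
  -- The score at time `n + 1` is a function of the history up to time `n` and of the last action;
  -- a history is extended to a trajectory by repeating its last entry.
  let ext (h : (i : Finset.Iic n) → EuclideanSpace ℝ (Fin d) × X × Ξ) (i : ℕ) :
      EuclideanSpace ℝ (Fin d) × X × Ξ := h ⟨min i n, Finset.mem_Iic.2 (min_le_right i n)⟩
  have hext : Measurable ext := measurable_pi_lambda _ fun i => measurable_pi_apply _
  have hscore : ∀ x ω, M.score β κ π A (n + 1) x (ext (Preorder.frestrictLe n ω)) =
      M.score β κ π A (n + 1) x ω := by
    intro x ω
    have h0 : ext (Preorder.frestrictLe n ω) 0 = ω 0 := congrArg ω (Nat.zero_min n)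
    have h1 : ∀ i < n + 1, ext (Preorder.frestrictLe n ω) i = ω i := fun i hi =>
      congrArg ω (min_eq_left (Nat.lt_succ_iff.1 hi))
    exact M.score_congr β κ π A x h0 h1
  let F (h : (i : Finset.Iic n) → EuclideanSpace ℝ (Fin d) × X × Ξ)
      (z : EuclideanSpace ℝ (Fin d) × X × Ξ) : EuclideanSpace ℝ (Fin m) :=
    w z.1 • M.score β κ π A (n + 1) z.2.1 (ext h)
  have hF : Measurable (Function.uncurry F) :=
    Measurable.smul (hw.comp measurable_snd.fst)
      (h.measurable_score (n + 1) measurable_snd.snd.fst (hext.comp measurable_fst))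
  have ha0 : 0 ≤ a := (abs_nonneg _).trans (ha 0)
  have hb : ∀ h z, ‖F h z‖ ≤ a * (Lπ * Ls) := fun g z => by
    rw [norm_smul, Real.norm_eq_abs]
    exact mul_le_mul (ha _) (h.norm_score_le _ _ _) (norm_nonneg _) ha0
  have hmarkov := M.integral_law_succ β κ π ρ n hF.stronglyMeasurable hb
  simp only [F, hscore] at hmarkov
  refine hmarkov.trans (integral_eq_zero_of_ae ?_)
  filter_upwards [M.ae_stateAlong_eq β κ π ρ, M.ae_law_succ_fst β κ π ρ n] with ω h1 h2
  have hk : StronglyMeasurable fun z : EuclideanSpace ℝ (Fin d) × X × Ξ =>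
      w z.1 • M.score β κ π A (n + 1) z.2.1 ω :=
    (Measurable.smul (hw.comp measurable_fst)
      (h.measurable_score (n + 1) measurable_snd.fst measurable_const)).stronglyMeasurable
  rw [M.integral_drawKernel π _ hk (a := a * (Lπ * Ls)) fun z => by
    simpa only [F, hscore] using hb (Preorder.frestrictLe n ω) z]
  have hsum := h.sum_prob_smul_score (n + 1) ω
  rw [h1, h2] at hsum
  simp_rw [integral_const, probReal_univ, one_smul, smul_comm _ (w _), ← Finset.smul_sum, hsum,
    smul_zero]
  rfl

end SensitiveOn

end HybridMDP

/-! ### The bound on the cross term -/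

namespace HybridMDP

section Gap

variable {d p m : ℕ} {X Ξ : Type*} [MeasurableSpace Ξ] [Fintype X] [MeasurableSpace X]
  [MeasurableSingletonClass X] {M : HybridMDP d p X Ξ} {β : M.ContinuousPolicy m}
  {κ : EuclideanSpace ℝ (Fin m)} {π πopt : DiscretePolicy d X} {γ R : ℝ}

theorem gap_nonneg (hopt : M.IsStatewiseBestResponse γ β κ πopt)
    {ρ : Measure (EuclideanSpace ℝ (Fin d))} (hρ : ∀ᵐ s ∂ρ, s ∈ M.S) :
    0 ≤ M.gap γ β κ π πopt ρ := by
  refine integral_nonneg_of_ae ?_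
  filter_upwards [hρ] with s hs
  exact sub_nonneg.2 (hopt s hs π)

/-- The expected advantage of the action played at time `t` over the optimal value is the
suboptimality gap with respect to the law of the state at time `t`. -/
theorem integral_clampActionValue_sub (hγ₀ : 0 ≤ γ) (hγ₁ : γ < 1) (hR : 0 ≤ R)
    (hcost : ∀ s ∈ M.S, ∀ x, ∀ b ∈ M.B x, ∀ ξ, |M.c s x b ξ| ≤ R)
    (ρ : Measure (EuclideanSpace ℝ (Fin d))) [IsProbabilityMeasure ρ] (hρ : ∀ᵐ s ∂ρ, s ∈ M.S)
    (t : ℕ) :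
    ∫ ω, (M.clampActionValue γ β κ π R (ω t).1 (ω t).2.1 -
        M.clampValue γ β κ πopt R (ω t).1) ∂M.law β κ π ρ =
      M.gap γ β κ π πopt ((M.law β κ π ρ).map fun ω => (ω t).1) := by
  have hs : Measurable fun ω : ℕ → EuclideanSpace ℝ (Fin d) × X × Ξ => (ω t).1 :=
    (measurable_pi_apply t).fst
  have hVm (π : DiscretePolicy d X) := M.stronglyMeasurable_clampValue β κ π hγ₀ hγ₁ hR
  have hk : StronglyMeasurable fun z : EuclideanSpace ℝ (Fin d) × X × Ξ =>
      M.clampActionValue γ β κ π R z.1 z.2.1 - M.clampValue γ β κ πopt R z.1 :=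
    (((M.measurable_clampActionValue β κ π hγ₀ hγ₁ hR).comp
      (measurable_fst.prodMk measurable_snd.fst)).sub
      ((hVm πopt).measurable.comp measurable_fst)).stronglyMeasurable
  have hb : ∀ z : EuclideanSpace ℝ (Fin d) × X × Ξ,
      ‖M.clampActionValue γ β κ π R z.1 z.2.1 - M.clampValue γ β κ πopt R z.1‖ ≤
        (1 - γ)⁻¹ * R + (1 - γ)⁻¹ * R := fun z =>
    (norm_sub_le _ _).trans (add_le_add (M.norm_clampActionValue_le β κ π hγ₀ hγ₁ hR _ _)
      (M.norm_clampValue_le β κ πopt hγ₀ hγ₁ hR _))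
  have hmem := M.ae_map_law_mem β κ π ρ hρ t
  have hgap : M.gap γ β κ π πopt ((M.law β κ π ρ).map fun ω => (ω t).1) =
      ∫ ω, (M.clampValue γ β κ π R (ω t).1 - M.clampValue γ β κ πopt R (ω t).1)
        ∂M.law β κ π ρ := by
    rw [← integral_map (f := fun s => M.clampValue γ β κ π R s - M.clampValue γ β κ πopt R s)
      hs.aemeasurable ((hVm π).sub (hVm πopt)).aestronglyMeasurable]
    refine integral_congr_ae ?_
    filter_upwards [hmem] with s hs
    rw [M.value_eq β κ π hγ₀ hγ₁ hR hcost hs, M.value_eq β κ πopt hγ₀ hγ₁ hR hcost hs]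
  rw [hgap, M.integral_law_eval β κ π ρ t hk hb]
  refine integral_congr_ae (ae_of_all _ fun ω => ?_)
  simp only
  rw [M.integral_drawKernel π _ hk hb]
  simp only [integral_const, probReal_univ, smul_eq_mul, mul_sub,
    Finset.sum_sub_distrib, ← Finset.sum_mul, π.sum_prob, one_mul,
    ← M.clampValue_eq_sum β κ π hγ₀ hγ₁ hR]

/-- The cross term at a single time `n + 1`: subtracting the optimal value as a baseline bounds it
by the sensitivity of the score times the suboptimality gap at the law of the state. -/
theorem SensitiveOn.norm_integral_scoreTerm_le {A : Set (EuclideanSpace ℝ (Fin d))}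
    {Lπ Ls : ℝ} (h : M.SensitiveOn β κ π A Lπ Ls) (hγ₀ : 0 ≤ γ) (hγ₁ : γ < 1) (hR : 0 ≤ R)
    (hcost : ∀ s ∈ M.S, ∀ x, ∀ b ∈ M.B x, ∀ ξ, |M.c s x b ξ| ≤ R)
    (hopt : M.IsStatewiseBestResponse γ β κ πopt)
    (ρ : Measure (EuclideanSpace ℝ (Fin d))) [IsProbabilityMeasure ρ] (hρ : ∀ᵐ s ∂ρ, s ∈ M.S)
    (n : ℕ) :
    ‖∫ ω, M.scoreTerm β κ π A (n + 1) (fun v => M.clampActionValue γ β κ π R v.1 v.2) ω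
        ∂M.law β κ π ρ‖ ≤
      M.gap γ β κ π πopt ((M.law β κ π ρ).map fun ω => (ω (n + 1)).1) * (Lπ * Ls) := by
  have hQm := M.measurable_clampActionValue β κ π hγ₀ hγ₁ hR
  have hVm := (M.stronglyMeasurable_clampValue β κ πopt hγ₀ hγ₁ hR).measurable
  have hQb := fun v : EuclideanSpace ℝ (Fin d) × X =>
    M.norm_clampActionValue_le β κ π hγ₀ hγ₁ hR v.1 v.2
  have hVb := M.norm_clampValue_le β κ πopt hγ₀ hγ₁ hR
  have hqm : Measurable fun v : EuclideanSpace ℝ (Fin d) × X =>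
      M.clampActionValue γ β κ π R v.1 v.2 - M.clampValue γ β κ πopt R v.1 :=
    hQm.sub (hVm.comp measurable_fst)
  have hqb : ∀ v : EuclideanSpace ℝ (Fin d) × X,
      |M.clampActionValue γ β κ π R v.1 v.2 - M.clampValue γ β κ πopt R v.1| ≤
        (1 - γ)⁻¹ * R + (1 - γ)⁻¹ * R := fun v =>
    (norm_sub_le _ _).trans (add_le_add (hQb v) (hVb v.1))
  have hzero := h.integral_scoreTerm_eq_zero ρ n hVm hVb
  have hsub : ∫ ω, M.scoreTerm β κ π A (n + 1)
      (fun v => M.clampActionValue γ β κ π R v.1 v.2) ω ∂M.law β κ π ρ =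
      ∫ ω, M.scoreTerm β κ π A (n + 1) (fun v =>
        M.clampActionValue γ β κ π R v.1 v.2 - M.clampValue γ β κ πopt R v.1) ω
        ∂M.law β κ π ρ := by
    rw [← sub_zero (∫ ω, M.scoreTerm β κ π A (n + 1)
      (fun v => M.clampActionValue γ β κ π R v.1 v.2) ω ∂M.law β κ π ρ), ← hzero,
      ← integral_sub (h.integrable_scoreTerm _ hQm hQb _)
        (h.integrable_scoreTerm _ (q := fun v => M.clampValue γ β κ πopt R v.1)
        (hVm.comp measurable_fst) (fun v => hVb v.1) _)]
    simp only [scoreTerm, sub_smul]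
  have hadv : Integrable (fun ω : ℕ → EuclideanSpace ℝ (Fin d) × X × Ξ =>
      M.clampActionValue γ β κ π R (ω (n + 1)).1 (ω (n + 1)).2.1 -
        M.clampValue γ β κ πopt R (ω (n + 1)).1) (M.law β κ π ρ) := by
    have hv : Measurable fun ω : ℕ → EuclideanSpace ℝ (Fin d) × X × Ξ =>
        ((ω (n + 1)).1, (ω (n + 1)).2.1) :=
      (measurable_pi_apply (n + 1)).fst.prodMk (measurable_pi_apply (n + 1)).snd.fst
    exact .of_bound (hqm.comp hv).aestronglyMeasurable _ (ae_of_all _ fun ω =>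
      hqb ((ω (n + 1)).1, (ω (n + 1)).2.1))
  rw [hsub, ← integral_clampActionValue_sub hγ₀ hγ₁ hR hcost ρ hρ (n + 1), ← integral_mul_const]
  refine norm_integral_le_of_norm_le (hadv.mul_const _) ?_
  filter_upwards [M.ae_law_mem β κ π ρ hρ] with ω hω
  refine (h.norm_scoreTerm_le _ _ ω).trans_eq ?_
  rw [abs_of_nonneg (sub_nonneg.2 (hopt.clampValue_le hγ₀ hγ₁ hR hcost π (hω (n + 1)) _))]

/-- Along almost every trajectory the summands of the cross term agree with their measurable and
bounded versions. -/
theorem SensitiveOn.ae_crossSummand_eq {A : Set (EuclideanSpace ℝ (Fin d))}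
    {Lπ Ls : ℝ} (h : M.SensitiveOn β κ π A Lπ Ls) (hγ₀ : 0 ≤ γ) (hγ₁ : γ < 1) (hR : 0 ≤ R)
    (hcost : ∀ s ∈ M.S, ∀ x, ∀ b ∈ M.B x, ∀ ξ, |M.c s x b ξ| ≤ R)
    (ρ : Measure (EuclideanSpace ℝ (Fin d))) [IsProbabilityMeasure ρ] (hA : ∀ᵐ s ∂ρ, s ∈ A) :
    ∀ᵐ ω ∂M.law β κ π ρ, M.crossSummand γ β κ π ω = fun t => γ ^ t •
      M.scoreTerm β κ π A t (fun v => M.clampActionValue γ β κ π R v.1 v.2) ω := by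
  have h0 : ∀ᵐ ω ∂M.law β κ π ρ, (ω 0).1 ∈ A := by
    refine ae_of_ae_map (p := fun s => s ∈ A) (measurable_pi_apply 0).fst.aemeasurable ?_
    rwa [map_law_zero_fst]
  filter_upwards [h0, M.ae_stateAlong_eq β κ π ρ,
    M.ae_law_mem β κ π ρ (hA.mono fun _ hs => h.subset hs)] with ω h0 h1 h2
  funext t
  rw [crossSummand, scoreTerm, score, Set.indicator_of_mem (by exact h0), h1, smul_smul,
    M.actionValue_eq β κ π hγ₀ hγ₁ hR hcost (h2 t)]

end Gap

end HybridMDP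

theorem theorem2 {d p m : ℕ} {X Ξ Φ : Type*} [Fintype X] [MeasurableSpace X]
    [MeasurableSingletonClass X] [MeasurableSpace Ξ]
    (M : HybridMDP d p X Ξ) (γ : ℝ) (hγ₀ : 0 < γ) (hγ₁ : γ < 1)
    -- bounded costs
    (hcost : ∃ R : ℝ, ∀ s ∈ M.S, ∀ x, ∀ b ∈ M.B x, ∀ ξ, |M.c s x b ξ| ≤ R)
    -- parameterized policy components, parameter set, initial state distribution
    (β : M.ContinuousPolicy m) (π : Φ → DiscretePolicy d X)
    (K : Set (EuclideanSpace ℝ (Fin m)))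
    (ρ : Measure (EuclideanSpace ℝ (Fin d))) [IsProbabilityMeasure ρ]
    (hρ : ∀ᵐ s ∂ρ, s ∈ M.S)
    (C Lπ Ls : ℝ)
    -- statewise best response
    (πstar : EuclideanSpace ℝ (Fin m) → DiscretePolicy d X)
    (hbest : ∀ κ ∈ K, M.IsStatewiseBestResponse γ β κ (πstar κ))
    -- uniform near-best response
    (hnear : ∀ κ ∈ K, ∀ φ : Φ, ∀ ε : ℝ, M.gap γ β κ (π φ) (πstar κ) ρ ≤ ε →
      ∀ ρ' : Measure (EuclideanSpace ℝ (Fin d)), IsProbabilityMeasure ρ' →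
        (∀ᵐ s ∂ρ', s ∈ M.S) → M.gap γ β κ (π φ) (πstar κ) ρ' ≤ C * ε)
    -- state sensitivity
    (hstate : ∀ κ ∈ K, ∀ᵐ s₀ ∂ρ, ∀ (x : ℕ → X) (ξ : ℕ → Ξ) (t : ℕ), 1 ≤ t →
      DifferentiableAt ℝ (M.stateAt β s₀ x ξ t) κ ∧
        ‖fderiv ℝ (M.stateAt β s₀ x ξ t) κ‖ ≤ Ls)
    -- score sensitivity
    (hpos : ∀ φ x, ∀ s ∈ M.S, 0 < (π φ).prob x s)
    (hscore : ∀ φ x, ∀ s ∈ M.S, ∃ g : EuclideanSpace ℝ (Fin d),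
      HasGradientWithinAt (fun s' => Real.log ((π φ).prob x s')) g M.S s ∧ ‖g‖ ≤ Lπ)
    -- an ε-best response
    (κ : EuclideanSpace ℝ (Fin m)) (hκ : κ ∈ K) (φ : Φ) (ε : ℝ)
    (hε : M.gap γ β κ (π φ) (πstar κ) ρ ≤ ε) :
    (∀ᵐ ω ∂(M.law β κ (π φ) ρ), Summable (M.crossSummand γ β κ (π φ) ω)) ∧
    Integrable (fun ω => ∑' t : ℕ, M.crossSummand γ β κ (π φ) ω t) (M.law β κ (π φ) ρ) ∧
    ‖∫ ω, ∑' t : ℕ, M.crossSummand γ β κ (π φ) ω t ∂(M.law β κ (π φ) ρ)‖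
      ≤ ε * (Lπ * Ls * (1 + C * γ / (1 - γ))) := by
  obtain ⟨R, hR, hcost⟩ :
      ∃ R : ℝ, 0 ≤ R ∧ ∀ s ∈ M.S, ∀ x, ∀ b ∈ M.B x, ∀ ξ, |M.c s x b ξ| ≤ R := by
    obtain ⟨R, h⟩ := hcost
    exact ⟨max R 0, le_max_right _ _,
      fun s hs x b hb ξ => (h s hs x b hb ξ).trans (le_max_left _ _)⟩
  have hopt := hbest κ hκ
  -- a measurable set of full measure of initial states at which the sensitivity bounds hold
  obtain ⟨A, hAρ, hAm, hA⟩ := (hρ.and (hstate κ hκ)).exists_measurable_mem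
  obtain ⟨s₁, hs₁⟩ : A.Nonempty := Filter.nonempty_of_mem hAρ
  have : Nonempty Ξ := M.noise.nonempty_of_neZero
  have : Nonempty X := by
    have := (π φ).isMarkovKernel_kernel
    exact ((π φ).kernel s₁).nonempty_of_neZero
  have h : M.SensitiveOn β κ (π φ) A Lπ Ls :=
    { measurableSet := hAm
      subset := fun s hs => (hA s hs).1
      state := fun s hs => (hA s hs).2
      pos := hpos φ
      gradient := hscore φ
      nonneg_left := by
        obtain ⟨g, -, hg⟩ := hscore φ (Classical.arbitrary X) s₁ (hA s₁ hs₁).1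
        exact (norm_nonneg g).trans hg
      nonneg_right := (norm_nonneg _).trans ((hA s₁ hs₁).2 (fun _ => Classical.arbitrary X)
        (fun _ => Classical.arbitrary Ξ) 1 le_rfl).2 }
  have hL : 0 ≤ Lπ * Ls := mul_nonneg h.nonneg_left h.nonneg_right
  set μ := M.law β κ (π φ) ρ
  let Y (t : ℕ) (ω : ℕ → EuclideanSpace ℝ (Fin d) × X × Ξ) : EuclideanSpace ℝ (Fin m) :=
    γ ^ t • M.scoreTerm β κ (π φ) A t
      (fun v => M.clampActionValue γ β κ (π φ) R v.1 v.2) ω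
  have hY : ∀ᵐ ω ∂μ, M.crossSummand γ β κ (π φ) ω = fun t => Y t ω :=
    h.ae_crossSummand_eq hγ₀.le hγ₁ hR hcost ρ hAρ
  let B := (1 - γ)⁻¹ * R * (Lπ * Ls)
  have hYb : ∀ t ω, ‖Y t ω‖ ≤ γ ^ t * B := fun t ω => by
    rw [norm_smul, Real.norm_of_nonneg (pow_nonneg hγ₀.le t)]
    exact mul_le_mul_of_nonneg_left ((h.norm_scoreTerm_le t _ ω).trans
      (mul_le_mul_of_nonneg_right
        (M.norm_clampActionValue_le β κ (π φ) hγ₀.le hγ₁ hR _ _) hL)) (pow_nonneg hγ₀.le t)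
  have hYm : ∀ t, Measurable (Y t) := fun t =>
    (h.measurable_scoreTerm t
      (M.measurable_clampActionValue β κ (π φ) hγ₀.le hγ₁ hR)).const_smul (γ ^ t)
  have hYint : ∀ t, Integrable (Y t) μ := fun t =>
    .of_bound (hYm t).aestronglyMeasurable (γ ^ t * B) (ae_of_all _ (hYb t))
  have hgeom := (hasSum_geometric_of_lt_one hγ₀.le hγ₁).mul_right B
  have hYsum : ∀ ω, Summable fun t => Y t ω := fun ω =>
    hgeom.summable.of_norm_bounded fun t => hYb t ω
  have htsum : (fun ω => ∑' t, M.crossSummand γ β κ (π φ) ω t) =ᵐ[μ] fun ω => ∑' t, Y t ω := by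
    filter_upwards [hY] with ω hω
    rw [hω]
  refine ⟨?_, ?_, ?_⟩
  · filter_upwards [hY] with ω hω
    rw [hω]
    exact hYsum ω
  · refine (integrable_congr htsum).2 (.of_bound ?_ ((1 - γ)⁻¹ * B)
      (ae_of_all _ fun ω => tsum_of_norm_bounded hgeom fun t => hYb t ω))
    refine aestronglyMeasurable_of_tendsto_ae Filter.atTop
      (f := fun n ω => ∑ t ∈ Finset.range n, Y t ω) (fun n => ?_)
      (ae_of_all _ fun ω => (hYsum ω).hasSum.tendsto_sum_nat)
    exact (Finset.measurable_fun_sum _ fun t _ => hYm t).aestronglyMeasurable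
  -- the initial state does not depend on `κ`, so the sum effectively starts at time `1`
  have hY0 : ∫ ω, Y 0 ω ∂μ = 0 := by
    simp [Y, HybridMDP.scoreTerm, HybridMDP.score_zero]
  have hYsucc : ∀ n, ‖∫ ω, Y (n + 1) ω ∂μ‖ ≤ γ ^ n * (γ * (C * ε * (Lπ * Ls))) := fun n => by
    have hprob : IsProbabilityMeasure (μ.map fun ω => (ω (n + 1)).1) :=
      Measure.isProbabilityMeasure_map (measurable_pi_apply (n + 1)).fst.aemeasurable
    have hgap := hnear κ hκ φ ε hε _ hprob (M.ae_map_law_mem β κ (π φ) ρ hρ (n + 1))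
    have hterm := h.norm_integral_scoreTerm_le hγ₀.le hγ₁ hR hcost hopt ρ hρ n
    rw [integral_smul, norm_smul, Real.norm_of_nonneg (pow_nonneg hγ₀.le _), pow_succ, mul_assoc]
    exact mul_le_mul_of_nonneg_left (mul_le_mul_of_nonneg_left
      (hterm.trans (mul_le_mul_of_nonneg_right hgap hL)) hγ₀.le) (pow_nonneg hγ₀.le n)
  have hnorm : Summable fun t => ∫ ω, ‖Y t ω‖ ∂μ :=
    hgeom.summable.of_norm_bounded fun t =>
      norm_integral_le_of_forall_norm_le _ fun ω => (norm_norm _).trans_le (hYb t ω)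
  have hint := hasSum_integral_of_summable_integral_norm hYint hnorm
  rw [integral_congr_ae htsum, ← hint.tsum_eq, hint.summable.tsum_eq_zero_add, hY0, zero_add]
  have hε₀ : 0 ≤ ε := (HybridMDP.gap_nonneg hopt hρ).trans hε
  calc ‖∑' n, ∫ ω, Y (n + 1) ω ∂μ‖ ≤ (1 - γ)⁻¹ * (γ * (C * ε * (Lπ * Ls))) :=
        tsum_of_norm_bounded ((hasSum_geometric_of_lt_one hγ₀.le hγ₁).mul_right _) hYsucc
    _ = ε * (Lπ * Ls * (1 + C * γ / (1 - γ))) - ε * (Lπ * Ls) := by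
        rw [div_eq_mul_inv]
        ring
    _ ≤ ε * (Lπ * Ls * (1 + C * γ / (1 - γ))) := sub_le_self _ (mul_nonneg hε₀ hL)
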